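/- Let $M$ be a compact complex manifold of dimension $n$, let $p_1,\dots,p_h$ be distinct points of $M$, and let $\pi\colon\tilde M\to M$ be the blowup of $M$ at $p_1,\dots,p_h$: $\pi$ is biholomorphic over $M\setminus\{p_1,\dots,p_h\}$, and over a coordinate neighbourhood $U_i$ of $p_i$ with coordinates $z=(z_1,\dots,z_n)$ centered at $p_i$ it is the projection $\{(z,l)\in U_i\times\mathbb P^{n-1} : z_al_b=z_bl_a \text{ for all } a,b\}\to U_i$. Let $E_i=\pi^{-1}(p_i)$ be the exceptional divisors, and let $n_1,\dots,n_h$ be positive integers. A holomorphic line bundle is called positive if it has a Hermitian metric such that $\frac{i}{2\pi}\Theta$ is a positive $(1,1)$-form, where $\Theta$ is the curvature form of the Chern connection of the metric; for a divisor $D$ with local defining functions $f_\alpha$, $[D]$ denotes the line bundle with transition functions $f_\alpha/f_\beta$. Then for every positive holomorphic line bundle $L$ on $M$ and every holomorphic line bundle $K$ on $M$ there is an integer $k_0$ such that for every integer $k\ge k_0$ with $k\ge 0$ the line bundle $$\pi^*(L^{\otimes k}\otimes K)\otimes\Big[-\sum_{i=1}^h n_iE_i\Big]$$ on $\tilde M$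 is positive. -/

import Mathlib

open Set Topology
open scoped Manifold ContDiff LinearAlgebra.Projectivization

noncomputable section

section LineBundles

/-- A holomorphic line bundle on a space `X` with charts in `ℂⁿ`, given by an open cover and
holomorphic transition functions: a vector bundle core with fibre `ℂ`. The associated bundle
`core.Fiber` is a holomorphic vector bundle of rank one. -/
structure HolLineBundle.{v, u} (n : ℕ) (X : Type u) [TopologicalSpace X]
    [ChartedSpace (Fin n → ℂ) X] : Type (max u (v + 1)) where
  ι : Type v
  core : VectorBundleCore ℂ X ℂ ι
  holo : core.IsContMDiff 𝓘(ℂ, Fin n → ℂ) ω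

namespace HolLineBundle

variable {n m : ℕ} {X : Type*} [TopologicalSpace X] [ChartedSpace (Fin n → ℂ) X]
  {Y : Type*} [TopologicalSpace Y] [ChartedSpace (Fin m → ℂ) Y]

/-- The domain of the `i`-th trivialization. -/
def dom (L : HolLineBundle n X) (i : L.ι) : Set X := L.core.baseSet i

/-- The transition functions: a vector with coordinate `v` in the `i`-th trivialization has
coordinate `trans i j x * v` in the `j`-th one. -/
def trans (L : HolLineBundle n X) (i j : L.ι) (x : X) : ℂ := L.core.coordChange i j x 1

/-- The line bundle with a given holomorphic cocycle of transition functions. -/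
def ofCocycle (ι : Type*) (U : ι → Set X) (hU : ∀ i, IsOpen (U i)) (idx : X → ι)
    (hidx : ∀ x, x ∈ U (idx x)) (g : ι → ι → X → ℂ)
    (hg : ∀ i j, ContMDiffOn 𝓘(ℂ, Fin n → ℂ) 𝓘(ℂ, ℂ) ω (g i j) (U i ∩ U j))
    (hself : ∀ i, ∀ x ∈ U i, g i i x = 1)
    (hcomp : ∀ i j k, ∀ x ∈ U i ∩ U j ∩ U k, g j k x * g i j x = g i k x) :
    HolLineBundle n X where
  ι := ι
  core :=
    { baseSet := U
      isOpen_baseSet := hU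
      indexAt := idx
      mem_baseSet_at := hidx
      coordChange := fun i j x => g i j x • ContinuousLinearMap.id ℂ ℂ
      coordChange_self := fun i x hx v => by simp [hself i x hx]
      continuousOn_coordChange := fun i j => (hg i j).continuousOn.smul continuousOn_const
      coordChange_comp := fun i j k x hx v => by
        simp [← hcomp i j k x hx, mul_assoc] }
  holo := ⟨fun i j => (hg i j).smul contMDiffOn_const⟩

@[simp] lemma trans_ofCocycle (ι : Type*) (U : ι → Set X) (hU : ∀ i, IsOpen (U i)) (idx : X → ι)
    (hidx : ∀ x, x ∈ U (idx x)) (g : ι → ι → X → ℂ)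
    (hg : ∀ i j, ContMDiffOn 𝓘(ℂ, Fin n → ℂ) 𝓘(ℂ, ℂ) ω (g i j) (U i ∩ U j))
    (hself : ∀ i, ∀ x ∈ U i, g i i x = 1)
    (hcomp : ∀ i j k, ∀ x ∈ U i ∩ U j ∩ U k, g j k x * g i j x = g i k x) (i j : ι) (x : X) :
    (ofCocycle ι U hU idx hidx g hg hself hcomp).trans i j x = g i j x := by
  simp [trans, ofCocycle]

lemma contMDiffOn_trans (L : HolLineBundle n X) (i j : L.ι) :
    ContMDiffOn 𝓘(ℂ, Fin n → ℂ) 𝓘(ℂ, ℂ) ω (L.trans i j) (L.dom i ∩ L.dom j) :=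
  (L.holo.contMDiffOn_coordChange i j).clm_apply contMDiffOn_const

lemma trans_self (L : HolLineBundle n X) (i : L.ι) (x : X) (hx : x ∈ L.dom i) :
    L.trans i i x = 1 := L.core.coordChange_self i x hx 1

lemma coordChange_eq (L : HolLineBundle n X) (i j : L.ι) (x : X) (v : ℂ) :
    L.core.coordChange i j x v = L.trans i j x * v := by
  have h := (L.core.coordChange i j x).map_smul v (1 : ℂ)
  simp only [smul_eq_mul, mul_one] at h
  rw [h, trans, mul_comm]

lemma trans_comp (L : HolLineBundle n X) (i j k : L.ι) (x : X)
    (hx : x ∈ L.dom i ∩ L.dom j ∩ L.dom k) :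
    L.trans j k x * L.trans i j x = L.trans i k x := by
  rw [← coordChange_eq]
  exact L.core.coordChange_comp i j k x hx 1

/-- Tensor product: transition functions are multiplied on a common refinement. -/
def tensor (L K : HolLineBundle n X) : HolLineBundle n X :=
  ofCocycle (L.ι × K.ι) (fun i => L.dom i.1 ∩ K.dom i.2)
    (fun i => (L.core.isOpen_baseSet i.1).inter (K.core.isOpen_baseSet i.2))
    (fun x => (L.core.indexAt x, K.core.indexAt x))
    (fun x => ⟨L.core.mem_baseSet_at x, K.core.mem_baseSet_at x⟩)
    (fun i j x => L.trans i.1 j.1 x * K.trans i.2 j.2 x)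
    (fun i j => ((L.contMDiffOn_trans i.1 j.1).mono fun _ h => ⟨h.1.1, h.2.1⟩).mul
      ((K.contMDiffOn_trans i.2 j.2).mono fun _ h => ⟨h.1.2, h.2.2⟩))
    (fun i x hx => by rw [L.trans_self i.1 x hx.1, K.trans_self i.2 x hx.2, mul_one])
    (fun i j k x hx => by
      rw [← L.trans_comp i.1 j.1 k.1 x ⟨⟨hx.1.1.1, hx.1.2.1⟩, hx.2.1⟩,
        ← K.trans_comp i.2 j.2 k.2 x ⟨⟨hx.1.1.2, hx.1.2.2⟩, hx.2.2⟩]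
      ring)

/-- Tensor power `L^{⊗ k}`: powers of the transition functions. -/
def tpow (L : HolLineBundle n X) (k : ℕ) : HolLineBundle n X :=
  ofCocycle L.ι L.dom L.core.isOpen_baseSet L.core.indexAt L.core.mem_baseSet_at
    (fun i j x => L.trans i j x ^ k) (fun i j => (L.contMDiffOn_trans i j).pow k)
    (fun i x hx => by rw [L.trans_self i x hx, one_pow])
    (fun i j l x hx => by rw [← mul_pow, L.trans_comp i j l x hx])

/-- Pullback along a holomorphic map. -/
def pullback (L : HolLineBundle n X) (f : Y → X)
    (hf : ContMDiff 𝓘(ℂ, Fin m → ℂ) 𝓘(ℂ, Fin n → ℂ) ω f) : HolLineBundle m Y :=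
  ofCocycle L.ι (fun i => f ⁻¹' L.dom i)
    (fun i => (L.core.isOpen_baseSet i).preimage hf.continuous)
    (fun y => L.core.indexAt (f y)) (fun y => L.core.mem_baseSet_at (f y))
    (fun i j y => L.trans i j (f y))
    (fun i j => (L.contMDiffOn_trans i j).comp hf.contMDiffOn fun _ h => h)
    (fun i y hy => L.trans_self i (f y) hy)
    (fun i j k y hy => L.trans_comp i j k (f y) hy)

/-- A Hermitian metric on a line bundle: a Hermitian inner product on each fibre, whose value on
the holomorphic frames of the trivializations is smooth. -/
structure HermitianMetric (L : HolLineBundle n X) where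
  inner : ∀ x, InnerProductSpace.Core ℂ (L.core.Fiber x)
  smooth : ∀ i, ContMDiffOn 𝓘(ℝ, Fin n → ℂ) 𝓘(ℝ, ℝ) ∞
    (fun x => ((inner x).inner ((L.core.localTriv i).symm x 1)
      ((L.core.localTriv i).symm x 1)).re) (L.dom i)

/-- `h = ⟨e, e⟩` for the holomorphic frame `e` of the `i`-th trivialization. -/
def HermitianMetric.normSq {L : HolLineBundle n X} (H : L.HermitianMetric) (i : L.ι) (x : X) : ℝ :=
  ((H.inner x).inner ((L.core.localTriv i).symm x 1) ((L.core.localTriv i).symm x 1)).re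

end HolLineBundle

section Curvature

variable {n : ℕ}

/-- The connection form `θ = h⁻¹ ∂h` of the Chern connection in a holomorphic frame `e` with
`⟨e, e⟩ = h`, where `(∂h)(v) = (dh(v) - i dh(iv)) / 2`. -/
def chernForm (h : (Fin n → ℂ) → ℝ) (z : Fin n → ℂ) : (Fin n → ℂ) →L[ℝ] ℂ :=
  (2 * (h z : ℂ))⁻¹ • (Complex.ofRealCLM ∘L fderiv ℝ h z -
    Complex.I • (Complex.ofRealCLM ∘L fderiv ℝ h z ∘L
      (Complex.I • ContinuousLinearMap.id ℂ (Fin n → ℂ)).restrictScalars ℝ))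

lemma chernForm_apply (h : (Fin n → ℂ) → ℝ) (z v : Fin n → ℂ) :
    chernForm h z v = (2 * (h z : ℂ))⁻¹ *
      ((fderiv ℝ h z v : ℂ) - Complex.I * (fderiv ℝ h z (Complex.I • v) : ℂ)) := by
  simp [chernForm]

/-- `θ = h⁻¹ ∂h` is the only form of type `(1,0)` (compatibility with the complex structure) with
`dh = hθ + h θ̄` (compatibility with the metric). -/
lemma eq_chernForm_iff (h : (Fin n → ℂ) → ℝ) (z : Fin n → ℂ) (hz : h z ≠ 0)
    (θ : (Fin n → ℂ) →L[ℝ] ℂ) :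
    θ = chernForm h z ↔ (∀ v, θ (Complex.I • v) = Complex.I * θ v) ∧
      ∀ v, (fderiv ℝ h z v : ℂ) = h z * θ v + h z * (starRingEnd ℂ) (θ v) := by
  have hz' : (h z : ℂ) ≠ 0 := by exact_mod_cast hz
  constructor
  · rintro rfl
    refine ⟨fun v => ?_, fun v => ?_⟩
    · rw [chernForm_apply, chernForm_apply, smul_smul, Complex.I_mul_I]
      simp only [neg_smul, one_smul, map_neg, Complex.ofReal_neg]
      linear_combination (2 * (h z : ℂ))⁻¹ * (fderiv ℝ h z (Complex.I • v) : ℂ) * Complex.I_mul_I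
    · rw [chernForm_apply]
      simp only [map_mul, map_sub, map_inv₀, Complex.conj_ofReal, Complex.conj_I, map_ofNat]
      field_simp
      ring
  · rintro ⟨h1, h2⟩
    ext v
    rw [chernForm_apply, h2 v, h2 (Complex.I • v), h1]
    simp only [map_mul, Complex.conj_I]
    field_simp
    linear_combination (θ v - (starRingEnd ℂ) (θ v)) * Complex.I_mul_I

/-- The curvature form `Θ = dθ` of the Chern connection, in local coordinates and a holomorphic
frame with `⟨e, e⟩ = h`. -/
def curvatureForm (h : (Fin n → ℂ) → ℝ) (z u v : Fin n → ℂ) : ℂ :=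
  fderiv ℝ (chernForm h) z u v - fderiv ℝ (chernForm h) z v u

/-- A positive `(1,1)`-form on `ℂⁿ`: invariant under multiplication by `i` (type `(1,1)`),
real, and with positive definite associated Hermitian form: for `v = (u - i·iu)/2` of
type `(1,0)` one has `-2i ω(v, v̄) = ω(u, iu)`. -/
def IsPositiveForm (η : (Fin n → ℂ) → (Fin n → ℂ) → ℂ) : Prop :=
  (∀ u v, η (Complex.I • u) (Complex.I • v) = η u v) ∧ (∀ u v, (η u v).im = 0) ∧
    ∀ u, u ≠ 0 → 0 < (η u (Complex.I • u)).re

end Curvature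

namespace HolLineBundle

variable {n : ℕ} {X : Type*} [TopologicalSpace X] [ChartedSpace (Fin n → ℂ) X]

/-- The curvature form at `x`, a 2-form on the tangent space at `x`, which is `ℂⁿ` through the
preferred chart at `x`, computed in the frame of the `i`-th trivialization. -/
def HermitianMetric.curvature {L : HolLineBundle n X} (H : L.HermitianMetric) (i : L.ι) (x : X)
    (u v : Fin n → ℂ) : ℂ :=
  curvatureForm (fun z => H.normSq i ((chartAt (Fin n → ℂ) x).symm z)) (chartAt (Fin n → ℂ) x x) u v

/-- `L` is positive: it has a Hermitian metric such that `(i/2π) Θ` is a positive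
`(1,1)`-form, for the curvature `Θ` of its Chern connection. -/
def IsPositive (L : HolLineBundle n X) : Prop :=
  ∃ H : L.HermitianMetric, ∀ i, ∀ x ∈ L.dom i,
    IsPositiveForm fun u v => Complex.I / (2 * Real.pi) * H.curvature i x u v

end HolLineBundle

end LineBundles

section Divisors

variable {n : ℕ} {X : Type*} [TopologicalSpace X] [ChartedSpace (Fin n → ℂ) X]

/-- Local defining functions, on a common open cover, of a finite family `V` of smooth
hypersurfaces: `f i c` is holomorphic on `U i`, vanishes there exactly on `V c`, to first order,
and `f i c`, `f j c` differ by a nowhere zero holomorphic function `unit i j c`. -/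
structure DefiningFunctions (n : ℕ) {X : Type*} [TopologicalSpace X] [ChartedSpace (Fin n → ℂ) X]
    {κ : Type*} (V : κ → Set X) where
  ι : Type*
  U : ι → Set X
  isOpen : ∀ i, IsOpen (U i)
  indexAt : X → ι
  mem_indexAt : ∀ x, x ∈ U (indexAt x)
  f : ι → κ → X → ℂ
  holo : ∀ i c, ContMDiffOn 𝓘(ℂ, Fin n → ℂ) 𝓘(ℂ, ℂ) ω (f i c) (U i)
  eq_zero_iff : ∀ i c, ∀ x ∈ U i, (f i c x = 0 ↔ x ∈ V c)
  simple : ∀ i c, ∀ x ∈ U i, x ∈ V c → mfderiv 𝓘(ℂ, Fin n → ℂ) 𝓘(ℂ, ℂ) (f i c) x ≠ 0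
  unit : ι → ι → κ → X → ℂ
  unit_holo : ∀ i j c, ContMDiffOn 𝓘(ℂ, Fin n → ℂ) 𝓘(ℂ, ℂ) ω (unit i j c) (U i ∩ U j)
  eq_unit_mul : ∀ i j c, ∀ x ∈ U i ∩ U j, f i c x = unit i j c x * f j c x
  unit_self : ∀ i c, ∀ x ∈ U i, unit i i c x = 1
  unit_comp : ∀ i j k c, ∀ x ∈ U i ∩ U j ∩ U k, unit i j c x * unit j k c x = unit i k c x

lemma DefiningFunctions.unit_ne_zero {κ : Type*} {V : κ → Set X} (D : DefiningFunctions n V)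
    (i j : D.ι) (c : κ) (x : X) (hx : x ∈ D.U i ∩ D.U j) : D.unit i j c x ≠ 0 := fun h => by
  have := D.unit_comp i j i c x ⟨hx, hx.1⟩
  rw [h, zero_mul, D.unit_self i c x hx.1] at this
  exact zero_ne_one this

/-- The line bundle `[∑ a_c V_c]` of a divisor. On `U i` the divisor is defined by the meromorphic
function `F i = ∏ c, f i c ^ a c`, and the functions `F i` are the coordinates of a meromorphic
section: the coordinate changes from `U i` to `U j` are `F j / F i = ∏ c, unit j i c ^ a c`. -/
def DefiningFunctions.lineBundle {κ : Type*} [Fintype κ] {V : κ → Set X}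
    (D : DefiningFunctions n V) (a : κ → ℤ) : HolLineBundle n X :=
  HolLineBundle.ofCocycle D.ι D.U D.isOpen D.indexAt D.mem_indexAt
    (fun i j x => ∏ c, D.unit j i c x ^ a c)
    (fun i j => by
      refine contMDiffOn_finsetProd fun c _ => ?_
      have h := (D.unit_holo j i c).mono (fun _ hx => ⟨hx.2, hx.1⟩ : D.U i ∩ D.U j ⊆ D.U j ∩ D.U i)
      cases hc : a c with
      | ofNat k => simpa using h.pow k
      | negSucc k =>
        simp only [zpow_negSucc]
        exact (h.pow (k + 1)).inv₀ fun x hx => pow_ne_zero _ (D.unit_ne_zero j i c x hx.symm))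
    (fun i x hx => by simp [D.unit_self i _ x hx])
    (fun i j k x hx => by
      rw [← Finset.prod_mul_distrib]
      refine Finset.prod_congr rfl fun c _ => ?_
      rw [← mul_zpow, D.unit_comp k j i c x ⟨⟨hx.2, hx.1.2⟩, hx.1.1⟩])

end Divisors

section BlowingUp

/-- The points of the blowup of an `n`-dimensional complex manifold `M` at a finite set `S` of
points: the points of `M` outside `S`, and for each `p ∈ S` the lines `l` through the origin of
`ℂⁿ`, where `ℂⁿ` is the range of the preferred chart at `p`, translated so that `p` is the origin. -/
inductive Blowup (n : ℕ) {M : Type*} (S : Finset M) : Type _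
  | off (x : M) (hx : x ∉ S) : Blowup n S
  | exc (p : M) (hp : p ∈ S) (l : ℙ ℂ (Fin n → ℂ)) : Blowup n S

namespace Blowup

variable {n : ℕ} {M : Type*} {S : Finset M}

/-- The projection `π` from the blowup to `M`. -/
def proj : Blowup n S → M
  | off x _ => x
  | exc p _ _ => p

/-- Near the fibre over a centre `p` with centered coordinates `z`, the local model is
`{(z, l) | z ∈ l}`, and a point of it is written as `(t d, [d])` with `d = dir p b` and
`t = scale b`: here `d = z`, `t = 1` off the centre, and `t = 0` over it. -/
def scale : Blowup n S → ℂ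
  | off _ _ => 1
  | exc _ _ _ => 0

/-- The `j`-th affine coordinates of `(t d, [d])`: `z_j = t d_j` and `z_m / z_j = d_m / d_j`. -/
def dirCoord (j : Fin n) (t : ℂ) (d : Fin n → ℂ) : Fin n → ℂ :=
  fun m => if m = j then t * d j else d m / d j

/-- The projection in the `j`-th affine coordinates: `w ↦ z` with `z_j = w_j`, `z_m = w_j w_m`. -/
def monoidal (j : Fin n) (w : Fin n → ℂ) : Fin n → ℂ := w j • Function.update w j 1

@[simp] lemma proj_off (x : M) (hx : x ∉ S) : proj (n := n) (off x hx) = x := rfl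
@[simp] lemma proj_exc (p : M) (hp : p ∈ S) (l : ℙ ℂ (Fin n → ℂ)) : proj (exc p hp l) = p := rfl
@[simp] lemma scale_off (x : M) (hx : x ∉ S) : scale (n := n) (off x hx) = 1 := rfl
@[simp] lemma scale_exc (p : M) (hp : p ∈ S) (l : ℙ ℂ (Fin n → ℂ)) : scale (exc p hp l) = 0 := rfl

lemma update_ne (j : Fin n) (w : Fin n → ℂ) : Function.update w j 1 ≠ 0 := fun h => by
  have := congrFun h j
  simp at this

lemma dirCoord_self (j : Fin n) (t : ℂ) (d : Fin n → ℂ) : dirCoord j t d j = t * d j := by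
  simp [dirCoord]

lemma dirCoord_smul (j : Fin n) (t c : ℂ) (hc : c ≠ 0) (d : Fin n → ℂ) :
    dirCoord j t (c • d) = dirCoord j (t * c) d := by
  funext m
  by_cases h : m = j <;> simp [dirCoord, h, mul_div_mul_left, hc, mul_assoc]

lemma dirCoord_update (j : Fin n) (w : Fin n → ℂ) :
    dirCoord j (w j) (Function.update w j 1) = w := by
  funext m
  by_cases h : m = j <;> simp [dirCoord, h]

lemma update_dirCoord (j : Fin n) (t : ℂ) (d : Fin n → ℂ) (hd : d j ≠ 0) :
    Function.update (dirCoord j t d) j 1 = (d j)⁻¹ • d := by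
  funext m
  by_cases h : m = j
  · subst h; simp [hd]
  · simp [dirCoord, h, div_eq_inv_mul]

lemma monoidal_dirCoord (j : Fin n) (t : ℂ) (d : Fin n → ℂ) (hd : d j ≠ 0) :
    monoidal j (dirCoord j t d) = t • d := by
  rw [monoidal, update_dirCoord j t d hd, dirCoord_self, smul_smul, mul_assoc,
    mul_inv_cancel₀ hd, mul_one]

lemma monoidal_eq_zero (j : Fin n) (w : Fin n → ℂ) : monoidal j w = 0 ↔ w j = 0 := by
  simp [monoidal, update_ne]

lemma contDiff_update (j : Fin n) : ContDiff ℂ ω (fun w : Fin n → ℂ => Function.update w j 1) := by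
  rw [contDiff_pi]
  intro m
  by_cases h : m = j
  · subst h; simpa using contDiff_const
  · simpa [h] using contDiff_apply ℂ ℂ m

lemma contDiff_monoidal (j : Fin n) : ContDiff ℂ ω (monoidal j) :=
  (contDiff_apply ℂ ℂ j).smul (contDiff_update j)

lemma contDiffOn_dirCoord {s : Set (Fin n → ℂ)} (j : Fin n) {t : (Fin n → ℂ) → ℂ}
    {d : (Fin n → ℂ) → Fin n → ℂ} (ht : ContDiffOn ℂ ω t s) (hd : ContDiffOn ℂ ω d s)
    (h0 : ∀ v ∈ s, d v j ≠ 0) : ContDiffOn ℂ ω (fun v => dirCoord j (t v) (d v)) s := by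
  rw [contDiffOn_pi] at hd ⊢
  intro m
  by_cases h : m = j
  · simpa [dirCoord, h] using ht.mul (hd j)
  · simp only [dirCoord, h, if_false]
    exact (hd m).div (hd j) h0

variable [TopologicalSpace M] [ChartedSpace (Fin n → ℂ) M]

variable (n) in
/-- Coordinates of `x` in the preferred chart at `p`, translated so that `p` is the origin. -/
def centered (p x : M) : Fin n → ℂ :=
  chartAt (Fin n → ℂ) p x - chartAt (Fin n → ℂ) p p

/-- Homogeneous coordinates of the line `l` of a point of the local model near `p`. -/
def dir (p : M) : Blowup n S → Fin n → ℂ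
  | off x _ => centered n p x
  | exc _ _ l => l.rep

@[simp] lemma dir_off (p x : M) (hx : x ∉ S) : dir (n := n) p (off x hx) = centered n p x := rfl
@[simp] lemma dir_exc (p q : M) (hp : q ∈ S) (l : ℙ ℂ (Fin n → ℂ)) :
    dir p (exc q hp l) = l.rep := rfl

variable (n S) in
open Classical in
/-- A chart of `M`, restricted to the complement of the centres. -/
def regChart (x₀ : {x : M // x ∉ S}) : PartialEquiv (Blowup n S) (Fin n → ℂ) where
  toFun b := chartAt (Fin n → ℂ) x₀.1 b.proj
  invFun v := if h : (chartAt (Fin n → ℂ) x₀.1).symm v ∉ S then off _ h else off x₀.1 x₀.2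
  source := {b | b.proj ∈ (chartAt (Fin n → ℂ) x₀.1).source ∧ b.proj ∉ S}
  target := {v | v ∈ (chartAt (Fin n → ℂ) x₀.1).target ∧ (chartAt (Fin n → ℂ) x₀.1).symm v ∉ S}
  map_source' := by
    rintro b ⟨h1, h2⟩
    exact ⟨OpenPartialHomeomorph.map_source _ h1, by
      rwa [OpenPartialHomeomorph.left_inv _ h1]⟩
  map_target' := by
    rintro v ⟨h1, h2⟩
    simp only [h2, not_false_eq_true, dite_true]
    exact ⟨OpenPartialHomeomorph.map_target _ h1, h2⟩
  left_inv' := by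
    rintro (⟨x, hx⟩ | ⟨p, hp, l⟩) ⟨h1, h2⟩
    · simp only [proj_off] at h1 h2
      simp [OpenPartialHomeomorph.left_inv _ h1, hx]
    · exact absurd hp h2
  right_inv' := by
    rintro v ⟨h1, h2⟩
    simp only [h2, not_false_eq_true, dite_true]
    exact OpenPartialHomeomorph.right_inv _ h1

variable (n) in
/-- The projection to `M` in the `j`-th affine coordinates over `p`. -/
def blowdown (p : M) (j : Fin n) (w : Fin n → ℂ) : M :=
  (chartAt (Fin n → ℂ) p).symm (chartAt (Fin n → ℂ) p p + monoidal j w)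

lemma blowdown_of_eq_zero (p : M) (j : Fin n) (w : Fin n → ℂ) (h : w j = 0) :
    blowdown n p j w = p := by
  simp [blowdown, (monoidal_eq_zero j w).2 h]

lemma centered_blowdown (p : M) (j : Fin n) (w : Fin n → ℂ)
    (h : chartAt (Fin n → ℂ) p p + monoidal j w ∈ (chartAt (Fin n → ℂ) p).target) :
    centered n p (blowdown n p j w) = monoidal j w := by
  simp [centered, blowdown, OpenPartialHomeomorph.right_inv _ h]

open Classical in
/-- The point with given `j`-th affine coordinates over `p`. -/
def excInv (p : M) (hp : p ∈ S) (j : Fin n) (w : Fin n → ℂ) : Blowup n S :=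
  if h : w j ≠ 0 ∧ blowdown n p j w ∉ S then off _ h.2
  else exc p hp (Projectivization.mk ℂ (Function.update w j 1) (update_ne j w))

lemma excInv_of_eq_zero (p : M) (hp : p ∈ S) (j : Fin n) (w : Fin n → ℂ) (hw : w j = 0) :
    excInv p hp j w =
      exc p hp (Projectivization.mk ℂ (Function.update w j 1) (update_ne j w)) := by
  simp [excInv, hw]

lemma excInv_of_ne_zero (p : M) (hp : p ∈ S) (j : Fin n) (w : Fin n → ℂ) (hw : w j ≠ 0)
    (h : blowdown n p j w ∉ S) : excInv p hp j w = off _ h := by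
  simp [excInv, hw, h]

variable (n S) in
/-- The domain of coordinates for the `j`-th chart at the exceptional divisor over `p`. -/
def excTarget (p : M) (j : Fin n) : Set (Fin n → ℂ) :=
  {w | chartAt (Fin n → ℂ) p p + monoidal j w ∈ (chartAt (Fin n → ℂ) p).target ∧
    (blowdown n p j w ∈ S → blowdown n p j w = p)}

lemma blowdown_notMem {p : M} {j : Fin n} {w : Fin n → ℂ} (h : w ∈ excTarget n S p j)
    (hw : w j ≠ 0) : blowdown n p j w ∉ S := by
  intro hS
  have h4 := centered_blowdown p j w h.1
  rw [h.2 hS] at h4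
  apply hw
  rw [← monoidal_eq_zero, ← h4]
  simp [centered]

variable (n S) in
/-- The `j`-th affine chart over the centre `p`, on the part of `{(z, l) | z ∈ l}` with `l_j ≠ 0`:
`(z, l) ↦ w` with `w_j = z_j` and `w_m = l_m / l_j` for `m ≠ j`. -/
def excChart (p : M) (hp : p ∈ S) (j : Fin n) : PartialEquiv (Blowup n S) (Fin n → ℂ) where
  toFun b := dirCoord j b.scale (b.dir p)
  invFun := excInv p hp j
  source := {b | b.proj ∈ (chartAt (Fin n → ℂ) p).source ∧ b.dir p j ≠ 0 ∧
    (b.proj ∈ S → b.proj = p)}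
  target := excTarget n S p j
  map_source' := by
    rintro (⟨x, hx⟩ | ⟨q, hq, l⟩) ⟨h1, h2, h3⟩
    · simp only [proj_off, dir_off] at h1 h2
      have e : chartAt (Fin n → ℂ) p p + monoidal j (dirCoord j 1 (centered n p x))
          = chartAt (Fin n → ℂ) p x := by
        rw [monoidal_dirCoord j _ _ h2]; simp [centered]
      refine ⟨?_, ?_⟩
      · simp only [scale_off, dir_off]
        rw [e]
        exact OpenPartialHomeomorph.map_source _ h1
      · simp only [scale_off, dir_off, blowdown, e, OpenPartialHomeomorph.left_inv _ h1]
        exact fun h => absurd h hx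
    · simp only [proj_exc, dir_exc] at h1 h2
      have e : dirCoord j 0 l.rep j = 0 := by simp [dirCoord_self]
      refine ⟨?_, fun _ => blowdown_of_eq_zero _ _ _ e⟩
      simp only [scale_exc, dir_exc]
      rw [(monoidal_eq_zero j _).2 e, add_zero]
      exact mem_chart_target _ p
  map_target' := by
    intro w hw'
    by_cases hw : w j = 0
    · rw [excInv_of_eq_zero _ _ _ _ hw]
      refine ⟨mem_chart_source _ p, ?_, fun _ => rfl⟩
      obtain ⟨a, ha⟩ := Projectivization.exists_smul_eq_mk_rep ℂ _ (update_ne j w)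
      rw [dir_exc, ← ha]
      simp [Units.smul_def]
    · have hn := blowdown_notMem hw' hw
      rw [excInv_of_ne_zero _ _ _ _ hw hn]
      refine ⟨OpenPartialHomeomorph.map_target _ hw'.1, ?_, fun h => absurd h hn⟩
      rw [dir_off, centered_blowdown p j w hw'.1]
      simpa [monoidal] using hw
  left_inv' := by
    rintro (⟨x, hx⟩ | ⟨q, hq, l⟩) ⟨h1, h2, h3⟩
    · simp only [proj_off, dir_off] at h1 h2
      have e : blowdown n p j (dirCoord j 1 (centered n p x)) = x := by
        rw [blowdown, monoidal_dirCoord j _ _ h2]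
        simp [centered, OpenPartialHomeomorph.left_inv _ h1]
      simp only [scale_off, dir_off]
      rw [excInv_of_ne_zero _ _ _ _ (by simpa [dirCoord_self] using h2) (by rwa [e])]
      congr
    · simp only [proj_exc, dir_exc] at h1 h2 h3
      obtain rfl := h3 hq
      simp only [scale_exc, dir_exc]
      rw [excInv_of_eq_zero _ _ _ _ (by simp [dirCoord_self])]
      congr 1
      conv_rhs => rw [← l.mk_rep]
      rw [Projectivization.mk_eq_mk_iff']
      exact ⟨(l.rep j)⁻¹, (update_dirCoord j 0 _ h2).symm⟩
  right_inv' := by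
    intro w hw'
    by_cases hw : w j = 0
    · rw [excInv_of_eq_zero _ _ _ _ hw]
      simp only [scale_exc, dir_exc]
      obtain ⟨a, ha⟩ := Projectivization.exists_smul_eq_mk_rep ℂ _ (update_ne j w)
      rw [← ha, Units.smul_def, dirCoord_smul _ _ _ a.ne_zero, zero_mul]
      conv_rhs => rw [← dirCoord_update j w, hw]
    · have hn := blowdown_notMem hw' hw
      rw [excInv_of_ne_zero _ _ _ _ hw hn]
      simp only [scale_off, dir_off]
      rw [centered_blowdown p j w hw'.1, monoidal, dirCoord_smul _ _ _ hw, one_mul,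
        dirCoord_update]

lemma continuousOn_blowdown (p : M) (j : Fin n) :
    ContinuousOn (blowdown n p j)
      {w | chartAt (Fin n → ℂ) p p + monoidal j w ∈ (chartAt (Fin n → ℂ) p).target} :=
  (chartAt (Fin n → ℂ) p).continuousOn_symm.comp
    (continuousOn_const.add (contDiff_monoidal j).continuous.continuousOn) (fun _ h => h)

lemma isOpen_pre (p : M) (j : Fin n) :
    IsOpen {w | chartAt (Fin n → ℂ) p p + monoidal j w ∈ (chartAt (Fin n → ℂ) p).target} :=
  (chartAt (Fin n → ℂ) p).open_target.preimage
    (continuous_const.add (contDiff_monoidal j).continuous)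

lemma isOpen_excTarget [T2Space M] (p : M) (j : Fin n) : IsOpen (excTarget n S p j) := by
  have : excTarget n S p j =
      {w | chartAt (Fin n → ℂ) p p + monoidal j w ∈ (chartAt (Fin n → ℂ) p).target} ∩
        blowdown n p j ⁻¹' ((S : Set M) \ {p})ᶜ := by
    ext w
    simp [excTarget, not_and, not_not]
  rw [this]
  exact (continuousOn_blowdown p j).isOpen_inter_preimage (isOpen_pre p j)
    (S.finite_toSet.subset sdiff_subset).isClosed.isOpen_compl

lemma isOpen_regTarget [T2Space M] (x₀ : {x : M // x ∉ S}) : IsOpen (regChart n S x₀).target := by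
  have : (regChart n S x₀).target = (chartAt (Fin n → ℂ) x₀.1).target ∩
      (chartAt (Fin n → ℂ) x₀.1).symm ⁻¹' (S : Set M)ᶜ := by
    ext v; simp [regChart]
  rw [this]
  exact (chartAt (Fin n → ℂ) x₀.1).continuousOn_symm.isOpen_inter_preimage
    (chartAt (Fin n → ℂ) x₀.1).open_target S.finite_toSet.isClosed.isOpen_compl

lemma regChart_symm {x₀ : {x : M // x ∉ S}} {v : Fin n → ℂ} (h : v ∈ (regChart n S x₀).target) :
    (regChart n S x₀).symm v = off _ h.2 := by
  simp only [PartialEquiv.symm, PartialEquiv.coe_mk]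
  exact dif_pos h.2

lemma excChart_symm (p : M) (hp : p ∈ S) (j : Fin n) :
    ⇑(excChart n S p hp j).symm = excInv p hp j := rfl

/-- Changes of coordinates from `e` to `e'` have an open domain and are holomorphic. -/
def Compat (e e' : PartialEquiv (Blowup n S) (Fin n → ℂ)) : Prop :=
  IsOpen (e.symm.trans e').source ∧ ContDiffOn ℂ ω (e.symm.trans e') (e.symm.trans e').source

/-- `m` describes, on `O`, the inverse of the chart `e` off the exceptional divisors. -/
structure OffData (S : Finset M) (e : PartialEquiv (Blowup n S) (Fin n → ℂ))
    (O : Set (Fin n → ℂ)) (m : (Fin n → ℂ) → M) : Prop where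
  isOpen : IsOpen O
  cont : ContinuousOn m O
  contDiffOn : ∀ y, ContDiffOn ℂ ω (fun v => chartAt (Fin n → ℂ) y (m v))
    (O ∩ m ⁻¹' (chartAt (Fin n → ℂ) y).source)
  symm_eq : ∀ v ∈ O, ∃ h : m v ∉ S, e.symm v = off (m v) h
  mem_iff : ∀ v, v ∈ O ↔ v ∈ e.target ∧ (e.symm v).proj ∉ S

lemma OffData.compat_reg {e : PartialEquiv (Blowup n S) (Fin n → ℂ)} {O : Set (Fin n → ℂ)}
    {m : (Fin n → ℂ) → M} (h : OffData S e O m) (y : {x : M // x ∉ S}) :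
    Compat e (regChart n S y) := by
  have hs : (e.symm.trans (regChart n S y)).source =
      O ∩ m ⁻¹' (chartAt (Fin n → ℂ) y.1).source := by
    ext v
    simp only [PartialEquiv.trans_source, PartialEquiv.symm_source, mem_inter_iff, mem_preimage]
    constructor
    · rintro ⟨h1, h2, h3⟩
      have hO := (h.mem_iff v).2 ⟨h1, h3⟩
      obtain ⟨h4, h5⟩ := h.symm_eq v hO
      rw [h5] at h2
      exact ⟨hO, h2⟩
    · rintro ⟨h1, h2⟩
      obtain ⟨h4, h5⟩ := h.symm_eq v h1
      refine ⟨((h.mem_iff v).1 h1).1, ?_⟩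
      rw [h5]
      exact ⟨h2, h4⟩
  rw [Compat, hs]
  refine ⟨h.cont.isOpen_inter_preimage h.isOpen (chartAt (Fin n → ℂ) y.1).open_source,
    (h.contDiffOn y.1).congr ?_⟩
  intro v hv
  obtain ⟨h4, h5⟩ := h.symm_eq v hv.1
  simp only [PartialEquiv.coe_trans, Function.comp, h5]
  rfl

lemma OffData.compat_exc {e : PartialEquiv (Blowup n S) (Fin n → ℂ)} {O : Set (Fin n → ℂ)}
    {m : (Fin n → ℂ) → M} (h : OffData S e O m) (q : M) (hq : q ∈ S) (k : Fin n)
    (hne : ∀ v ∈ e.target, (e.symm v).proj ≠ q) :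
    Compat e (excChart n S q hq k) := by
  have hs : (e.symm.trans (excChart n S q hq k)).source =
      (O ∩ m ⁻¹' (chartAt (Fin n → ℂ) q).source) ∩
        (fun v => centered n q (m v) k) ⁻¹' {0}ᶜ := by
    ext v
    simp only [PartialEquiv.trans_source, PartialEquiv.symm_source, mem_inter_iff, mem_preimage]
    constructor
    · rintro ⟨h1, h2, h3, h6⟩
      have hO := (h.mem_iff v).2 ⟨h1, fun h7 => hne v h1 (h6 h7)⟩
      obtain ⟨h4, h5⟩ := h.symm_eq v hO
      rw [h5] at h2 h3
      exact ⟨⟨hO, h2⟩, h3⟩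
    · rintro ⟨⟨h1, h2⟩, h3⟩
      obtain ⟨h4, h5⟩ := h.symm_eq v h1
      refine ⟨((h.mem_iff v).1 h1).1, ?_⟩
      rw [h5]
      exact ⟨h2, h3, fun h8 => absurd h8 h4⟩
  have hc : ContDiffOn ℂ ω (fun v => centered n q (m v))
      (O ∩ m ⁻¹' (chartAt (Fin n → ℂ) q).source) := (h.contDiffOn q).sub contDiffOn_const
  rw [Compat, hs]
  refine ⟨ContinuousOn.isOpen_inter_preimage ((continuous_apply k).comp_continuousOn
    hc.continuousOn) (h.cont.isOpen_inter_preimage h.isOpen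
      (chartAt (Fin n → ℂ) q).open_source) isOpen_compl_singleton, ?_⟩
  refine (contDiffOn_dirCoord k (contDiffOn_const (c := 1)) (hc.mono inter_subset_left)
    (fun v hv => hv.2)).congr ?_
  intro v hv
  obtain ⟨h4, h5⟩ := h.symm_eq v hv.1.1
  simp only [PartialEquiv.coe_trans, Function.comp, h5]
  rfl

lemma contDiffOn_change [IsManifold 𝓘(ℂ, Fin n → ℂ) ω M] (p q : M) :
    ContDiffOn ℂ ω (fun v => chartAt (Fin n → ℂ) q ((chartAt (Fin n → ℂ) p).symm v))
      ((chartAt (Fin n → ℂ) p).target ∩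
        (chartAt (Fin n → ℂ) p).symm ⁻¹' (chartAt (Fin n → ℂ) q).source) := by
  have := contDiffOn_ext_coord_change (I := 𝓘(ℂ, Fin n → ℂ)) (n := ω) q p
  simpa [PartialEquiv.trans_source, Function.comp_def] using this

lemma offData_reg [T2Space M] [IsManifold 𝓘(ℂ, Fin n → ℂ) ω M] (x₀ : {x : M // x ∉ S}) :
    OffData S (regChart n S x₀) (regChart n S x₀).target (chartAt (Fin n → ℂ) x₀.1).symm where
  isOpen := isOpen_regTarget x₀
  cont := (chartAt (Fin n → ℂ) x₀.1).continuousOn_symm.mono fun v h => h.1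
  contDiffOn y := (contDiffOn_change x₀.1 y).mono fun v h => ⟨h.1.1, h.2⟩
  symm_eq v hv := ⟨hv.2, regChart_symm hv⟩
  mem_iff v := by
    refine ⟨fun h => ⟨h, ?_⟩, fun h => h.1⟩
    rw [regChart_symm h]
    exact h.2

lemma offData_exc [T2Space M] [IsManifold 𝓘(ℂ, Fin n → ℂ) ω M] (p : M) (hp : p ∈ S) (j : Fin n) :
    OffData S (excChart n S p hp j) (excTarget n S p j ∩ {w | w j ≠ 0}) (blowdown n p j) where
  isOpen := (isOpen_excTarget p j).inter
    (isOpen_compl_singleton.preimage (continuous_apply (A := fun _ : Fin n => ℂ) j))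
  cont := (continuousOn_blowdown p j).mono fun v h => h.1.1
  contDiffOn y := (contDiffOn_change p y).comp
    (contDiff_const.add (contDiff_monoidal j)).contDiffOn fun v h => ⟨h.1.1.1, h.2⟩
  symm_eq v hv := ⟨blowdown_notMem hv.1 hv.2, excInv_of_ne_zero _ _ _ _ hv.2 _⟩
  mem_iff v := by
    rw [excChart_symm]
    refine ⟨fun h => ⟨h.1, ?_⟩, fun h => ⟨h.1, fun h0 => h.2 ?_⟩⟩
    · rw [excInv_of_ne_zero _ _ _ _ h.2 (blowdown_notMem h.1 h.2)]
      exact blowdown_notMem h.1 h.2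
    · rw [excInv_of_eq_zero _ _ _ _ h0]
      exact hp

lemma compat_exc_exc [T2Space M] (p : M) (hp : p ∈ S) (j k : Fin n) :
    Compat (excChart n S p hp j) (excChart n S p hp k) := by
  have key : ∀ w ∈ excTarget n S p j, ∃ a : ℂ, a ≠ 0 ∧
      (excInv p hp j w).dir p = a • Function.update w j 1 ∧
      (excInv p hp j w).scale * a = w j ∧
      (excInv p hp j w).proj ∈ (chartAt (Fin n → ℂ) p).source ∧
      ((excInv p hp j w).proj ∈ S → (excInv p hp j w).proj = p) := by
    intro w hw'
    have hsrc := (excChart n S p hp j).map_target hw'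
    rw [excChart_symm] at hsrc
    by_cases hw : w j = 0
    · obtain ⟨a, ha⟩ := Projectivization.exists_smul_eq_mk_rep ℂ _ (update_ne j w)
      refine ⟨a, a.ne_zero, ?_, ?_, hsrc.1, hsrc.2.2⟩
      · rw [excInv_of_eq_zero _ _ _ _ hw, dir_exc, ← ha, Units.smul_def]
      · rw [excInv_of_eq_zero _ _ _ _ hw, scale_exc, hw, zero_mul]
    · refine ⟨w j, hw, ?_, ?_, hsrc.1, hsrc.2.2⟩
      · rw [excInv_of_ne_zero _ _ _ _ hw (blowdown_notMem hw' hw), dir_off,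
          centered_blowdown p j w hw'.1, monoidal]
      · rw [excInv_of_ne_zero _ _ _ _ hw (blowdown_notMem hw' hw), scale_off, one_mul]
  have hs : ((excChart n S p hp j).symm.trans (excChart n S p hp k)).source =
      excTarget n S p j ∩ (fun w : Fin n → ℂ => Function.update w j 1 k) ⁻¹' {0}ᶜ := by
    ext w
    simp only [PartialEquiv.trans_source, PartialEquiv.symm_source, mem_inter_iff, mem_preimage]
    constructor
    · rintro ⟨h1, -, h3, -⟩
      obtain ⟨a, ha, h4, -⟩ := key w h1
      refine ⟨h1, fun h0 => h3 ?_⟩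
      rw [excChart_symm, h4]
      simp only [mem_singleton_iff] at h0
      simp [h0]
    · rintro ⟨h1, h2⟩
      obtain ⟨a, ha, h4, -, h6, h7⟩ := key w h1
      refine ⟨h1, h6, ?_, h7⟩
      rw [excChart_symm, h4]
      simpa [ha] using h2
  have hk : Continuous (fun w : Fin n → ℂ => Function.update w j 1 k) :=
    (continuous_apply k).comp (contDiff_update j).continuous
  rw [Compat, hs]
  refine ⟨(isOpen_excTarget p j).inter (isOpen_compl_singleton.preimage hk), ?_⟩
  refine (contDiffOn_dirCoord k (contDiff_apply ℂ ℂ j).contDiffOn (contDiff_update j).contDiffOn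
    (fun v hv => hv.2)).congr ?_
  intro w hw
  obtain ⟨a, ha, h4, h5, -⟩ := key w hw.1
  simp only [PartialEquiv.coe_trans, Function.comp, excChart_symm]
  change dirCoord k (excInv p hp j w).scale ((excInv p hp j w).dir p) = _
  rw [h4, dirCoord_smul _ _ _ ha, h5]

variable (n S) in
/-- The atlas: a chart at each point off the centres, `n` charts over each centre. -/
def charts : Set (PartialEquiv (Blowup n S) (Fin n → ℂ)) :=
  range (regChart n S) ∪ {e | ∃ (p : M) (hp : p ∈ S) (j : Fin n), e = excChart n S p hp j}

lemma compat_charts [T2Space M] [IsManifold 𝓘(ℂ, Fin n → ℂ) ω M]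
    {e e' : PartialEquiv (Blowup n S) (Fin n → ℂ)} (he : e ∈ charts n S) (he' : e' ∈ charts n S) :
    Compat e e' := by
  rcases he with ⟨x, rfl⟩ | ⟨p, hp, j, rfl⟩ <;> rcases he' with ⟨y, rfl⟩ | ⟨q, hq, k, rfl⟩
  · exact (offData_reg x).compat_reg y
  · refine (offData_reg x).compat_exc q hq k fun v hv h => ?_
    rw [regChart_symm hv] at h
    exact hv.2 (by rw [proj_off] at h; rwa [h])
  · exact (offData_exc p hp j).compat_reg y
  · by_cases hpq : p = q
    · subst hpq
      exact compat_exc_exc p hp j k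
    · refine (offData_exc p hp j).compat_exc q hq k fun v hv h => hpq ?_
      rw [excChart_symm] at h
      have h2 := ((excChart n S p hp j).map_target hv).2.2
      rw [excChart_symm, h] at h2
      exact (h2 hq).symm

lemma exists_coord (l : ℙ ℂ (Fin n → ℂ)) : ∃ j, l.rep j ≠ 0 := by
  by_contra! h
  exact l.rep_nonzero (funext h)

variable (n S) in
/-- The preferred chart at a point of the blowup. -/
def preferredChart : Blowup n S → PartialEquiv (Blowup n S) (Fin n → ℂ)
  | off x hx => regChart n S ⟨x, hx⟩
  | exc p hp l => excChart n S p hp (exists_coord l).choose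

lemma excChart_mem (p : M) (hp : p ∈ S) (j : Fin n) : excChart n S p hp j ∈ charts n S :=
  Or.inr ⟨p, hp, j, rfl⟩

lemma regChart_mem (x : {x : M // x ∉ S}) : regChart n S x ∈ charts n S := Or.inl ⟨x, rfl⟩

lemma proj_excInv {p : M} {hp : p ∈ S} {j : Fin n} {w : Fin n → ℂ} (hw : w ∈ excTarget n S p j) :
    (excInv p hp j w).proj = blowdown n p j w := by
  by_cases h : w j = 0
  · rw [excInv_of_eq_zero _ _ _ _ h, proj_exc, blowdown_of_eq_zero _ _ _ h]
  · rw [excInv_of_ne_zero _ _ _ _ h (blowdown_notMem hw h), proj_off]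

/-- The exceptional divisor over the centre `p`. -/
def exceptional (p : {x : M // x ∈ S}) : Set (Blowup n S) := proj ⁻¹' {p.1}

/-- The cover of the blowup: the complement of the exceptional divisors, and the domains of the
charts along the exceptional divisors. -/
def coverSet : Option ({x : M // x ∈ S} × Fin n) → Set (Blowup n S)
  | none => {b | b.proj ∉ S}
  | some (q, j) => (excChart n S q.1 q.2 j).source

open Classical in
/-- The local equation of the exceptional divisor over `p`: the coordinate `z_j` in the `j`-th
chart over `p`, and `1` elsewhere. -/
def equation : Option ({x : M // x ∈ S} × Fin n) → {x : M // x ∈ S} → Blowup n S → ℂ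
  | none, _, _ => 1
  | some (q, j), p, b => if q = p then b.scale * b.dir q.1 j else 1

/-- `z_j` up to a common factor: the `j`-th homogeneous coordinate. -/
def homCoord : Option ({x : M // x ∈ S} × Fin n) → Blowup n S → ℂ
  | none, _ => 1
  | some (q, j), b => b.dir q.1 j

/-- Ratios of local equations; over the centre, the ratio `z_i / z_j = l_i / l_j` of homogeneous
coordinates. -/
def ratio (i j : Option ({x : M // x ∈ S} × Fin n)) (p : {x : M // x ∈ S}) (b : Blowup n S) : ℂ :=
  open Classical in
  if equation j p b = 0 then homCoord i b / homCoord j b else equation i p b / equation j p b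

lemma equation_eq_zero_iff (i : Option ({x : M // x ∈ S} × Fin n)) (p : {x : M // x ∈ S})
    (b : Blowup n S) (hb : b ∈ coverSet i) : equation i p b = 0 ↔ b ∈ exceptional p := by
  rcases i with _ | ⟨q, j⟩
  · simp only [equation, one_ne_zero, exceptional, mem_preimage, mem_singleton_iff, false_iff]
    intro h
    exact hb (by rw [h]; exact p.2)
  · obtain ⟨h1, h2, h3⟩ := hb
    rcases b with ⟨x, hx⟩ | ⟨r, hr, l⟩
    · have hxp : x ≠ p.1 := fun h => hx (h ▸ p.2)
      by_cases hq : q = p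
      · simpa [equation, hq, exceptional, hxp] using hq ▸ h2
      · simp [equation, hq, exceptional, hxp]
    · have hrq : r = q.1 := h3 hr
      by_cases hq : q = p
      · simp [equation, hq, exceptional, hrq]
      · have hqp : q.1 ≠ p.1 := fun h => hq (Subtype.ext h)
        simp [equation, hq, exceptional, hrq, hqp]

lemma homCoord_ne_zero (i : Option ({x : M // x ∈ S} × Fin n)) (b : Blowup n S)
    (hb : b ∈ coverSet i) : homCoord i b ≠ 0 := by
  rcases i with _ | ⟨q, j⟩
  · exact one_ne_zero
  · exact hb.2.1

lemma equation_self (p : {x : M // x ∈ S}) (j : Fin n) (b : Blowup n S) :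
    equation (some (p, j)) p b = excChart n S p.1 p.2 j b j := by
  simp only [equation, if_true]
  exact (dirCoord_self j _ _).symm

variable [T2Space M] [IsManifold 𝓘(ℂ, Fin n → ℂ) ω M]

variable (n S) in
/-- The atlas of the blowup, before a topology is chosen. -/
def chartedSpaceCore : ChartedSpaceCore (Fin n → ℂ) (Blowup n S) where
  atlas := charts n S
  chartAt := preferredChart n S
  mem_chart_source := by
    rintro (⟨x, hx⟩ | ⟨p, hp, l⟩)
    · exact ⟨mem_chart_source _ x, hx⟩
    · exact ⟨mem_chart_source _ p, (exists_coord l).choose_spec, fun _ => rfl⟩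
  chart_mem_atlas := by
    rintro (⟨x, hx⟩ | ⟨p, hp, l⟩)
    · exact Or.inl ⟨_, rfl⟩
    · exact Or.inr ⟨p, hp, _, rfl⟩
  open_source e e' he he' := (compat_charts he he').1
  continuousOn_toFun e e' he he' := (compat_charts he he').2.continuousOn

instance : TopologicalSpace (Blowup n S) := (chartedSpaceCore n S).toTopologicalSpace

instance : ChartedSpace (Fin n → ℂ) (Blowup n S) := (chartedSpaceCore n S).toChartedSpace

instance : IsManifold 𝓘(ℂ, Fin n → ℂ) ω (Blowup n S) := by
  refine isManifold_of_contDiffOn _ _ _ fun e e' he he' => ?_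
  simp only [atlas, ChartedSpace.atlas, mem_iUnion, mem_singleton_iff] at he he'
  obtain ⟨f, hf, rfl⟩ := he
  obtain ⟨f', hf', rfl⟩ := he'
  have h := (compat_charts hf hf').2
  simp only [modelWithCornersSelf_coe, modelWithCornersSelf_coe_symm, range_id, inter_univ,
    preimage_id, Function.id_comp, Function.comp_id]
  exact h


/-- The chart of the blowup given by a member of the atlas. -/
def homeo (e : PartialEquiv (Blowup n S) (Fin n → ℂ)) (he : e ∈ charts n S) :
    OpenPartialHomeomorph (Blowup n S) (Fin n → ℂ) :=
  (chartedSpaceCore n S).openPartialHomeomorph e he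

lemma homeo_mem_maximalAtlas (e : PartialEquiv (Blowup n S) (Fin n → ℂ)) (he : e ∈ charts n S) :
    homeo e he ∈ IsManifold.maximalAtlas 𝓘(ℂ, Fin n → ℂ) ω (Blowup n S) :=
  IsManifold.subset_maximalAtlas (mem_iUnion₂.2 ⟨e, he, rfl⟩)

lemma contMDiffOn_chart {e : PartialEquiv (Blowup n S) (Fin n → ℂ)} (he : e ∈ charts n S) :
    ContMDiffOn 𝓘(ℂ, Fin n → ℂ) 𝓘(ℂ, Fin n → ℂ) ω e e.source :=
  contMDiffOn_of_mem_maximalAtlas (homeo_mem_maximalAtlas e he)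

lemma contMDiffOn_of_symm {E N : Type*} [NormedAddCommGroup E] [NormedSpace ℂ E]
    [TopologicalSpace N] [ChartedSpace E N] {f : Blowup n S → N}
    {e : PartialEquiv (Blowup n S) (Fin n → ℂ)} (he : e ∈ charts n S)
    (h : ContMDiffOn 𝓘(ℂ, Fin n → ℂ) 𝓘(ℂ, E) ω (f ∘ e.symm) e.target) :
    ContMDiffOn 𝓘(ℂ, Fin n → ℂ) 𝓘(ℂ, E) ω f e.source :=
  (h.comp (contMDiffOn_chart he) e.mapsTo).congr fun x hx => by
    simp [e.left_inv hx]

lemma isOpen_chart_source {e : PartialEquiv (Blowup n S) (Fin n → ℂ)} (he : e ∈ charts n S) :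
    IsOpen e.source := (homeo e he).open_source

variable (n S) in
/-- The projection from the blowup is holomorphic. -/
theorem contMDiff_proj :
    ContMDiff 𝓘(ℂ, Fin n → ℂ) 𝓘(ℂ, Fin n → ℂ) ω (proj : Blowup n S → M) := by
  have hsymm : ∀ p : M, ContMDiffOn 𝓘(ℂ, Fin n → ℂ) 𝓘(ℂ, Fin n → ℂ) ω
      (chartAt (Fin n → ℂ) p).symm (chartAt (Fin n → ℂ) p).target := fun p =>
    contMDiffOn_chart_symm
  have key : ∀ e ∈ charts n S, ContMDiffOn 𝓘(ℂ, Fin n → ℂ) 𝓘(ℂ, Fin n → ℂ) ω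
      (proj : Blowup n S → M) e.source := by
    rintro e (⟨x, rfl⟩ | ⟨p, hp, j, rfl⟩)
    · refine contMDiffOn_of_symm (regChart_mem x) (((hsymm x.1).mono fun v hv => hv.1).congr ?_)
      intro v hv
      rw [Function.comp_apply, regChart_symm hv, proj_off]
    · refine contMDiffOn_of_symm (excChart_mem p hp j) (((hsymm p).comp
        (contDiff_const.add (contDiff_monoidal j)).contMDiff.contMDiffOn
        fun v hv => hv.1).congr ?_)
      intro v hv
      rw [Function.comp_apply, excChart_symm, proj_excInv hv]
      rfl
  intro b
  exact (key _ ((chartedSpaceCore n S).chart_mem_atlas b)).contMDiffAt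
    ((isOpen_chart_source ((chartedSpaceCore n S).chart_mem_atlas b)).mem_nhds
      ((chartedSpaceCore n S).mem_chart_source b))

lemma isOpen_coverSet (i : Option ({x : M // x ∈ S} × Fin n)) :
    IsOpen (coverSet i : Set (Blowup n S)) := by
  rcases i with _ | ⟨q, j⟩
  · exact S.finite_toSet.isClosed.isOpen_compl.preimage (contMDiff_proj n S).continuous
  · exact isOpen_chart_source (excChart_mem q.1 q.2 j)

lemma contMDiffOn_excChart_comp (p : M) (hp : p ∈ S) (j : Fin n) {g : (Fin n → ℂ) → ℂ}
    (hg : ContDiff ℂ ω g) : ContMDiffOn 𝓘(ℂ, Fin n → ℂ) 𝓘(ℂ, ℂ) ω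
      (fun b => g (excChart n S p hp j b)) (excChart n S p hp j).source :=
  hg.contMDiff.comp_contMDiffOn (contMDiffOn_chart (excChart_mem p hp j))

lemma contMDiffOn_equation (i : Option ({x : M // x ∈ S} × Fin n)) (p : {x : M // x ∈ S}) :
    ContMDiffOn 𝓘(ℂ, Fin n → ℂ) 𝓘(ℂ, ℂ) ω (equation i p : Blowup n S → ℂ) (coverSet i) := by
  rcases i with _ | ⟨q, j⟩
  · exact contMDiffOn_const
  · by_cases hq : q = p
    · subst hq
      exact (contMDiffOn_excChart_comp q.1 q.2 j (contDiff_apply ℂ ℂ j)).congr fun b _ =>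
        equation_self q j b
    · exact contMDiffOn_const.congr (f := fun _ => 1) fun b _ => by simp [equation, hq]

lemma mfderiv_equation_ne_zero (i : Option ({x : M // x ∈ S} × Fin n)) (p : {x : M // x ∈ S})
    (b : Blowup n S) (hb : b ∈ coverSet i) (hbp : b ∈ exceptional p) :
    mfderiv 𝓘(ℂ, Fin n → ℂ) 𝓘(ℂ, ℂ) (equation i p) b ≠ 0 := by
  have h0 := (equation_eq_zero_iff i p b hb).2 hbp
  rcases i with _ | ⟨q, j⟩
  · exact absurd h0 one_ne_zero
  · by_cases hq : q = p
    · subst hq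
      intro hder
      set e := homeo (excChart n S q.1 q.2 j) (excChart_mem q.1 q.2 j) with he
      have hbe : b ∈ e.source := hb
      have hs : MDifferentiableAt 𝓘(ℂ, Fin n → ℂ) 𝓘(ℂ, Fin n → ℂ) e.symm (e b) :=
        ((contMDiffOn_symm_of_mem_maximalAtlas (homeo_mem_maximalAtlas _ _)).contMDiffAt
          (e.open_target.mem_nhds (e.map_source hbe))).mdifferentiableAt (by simp)
      have hf : MDifferentiableAt 𝓘(ℂ, Fin n → ℂ) 𝓘(ℂ, ℂ)
          (equation (some (q, j)) q : Blowup n S → ℂ) (e.symm (e b)) := by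
        rw [e.left_inv hbe]
        exact ((contMDiffOn_equation (some (q, j)) q).contMDiffAt
          ((isOpen_coverSet _).mem_nhds hb)).mdifferentiableAt (by simp)
      have hcomp := mfderiv_comp (e b) hf hs
      rw [e.left_inv hbe, hder] at hcomp
      have heq : (equation (some (q, j)) q : Blowup n S → ℂ) ∘ e.symm =ᶠ[𝓝 (e b)]
          fun w => w j := by
        filter_upwards [e.open_target.mem_nhds (e.map_source hbe)] with w hw
        rw [Function.comp_apply, equation_self]
        exact congrFun (e.right_inv hw) j
      rw [heq.mfderiv_eq, mfderiv_eq_fderiv] at hcomp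
      have h1 : fderiv ℂ (fun w : Fin n → ℂ => w j) (e b) = ContinuousLinearMap.proj j :=
        (ContinuousLinearMap.proj (R := ℂ) (φ := fun _ : Fin n => ℂ) j).fderiv
      have h2 := DFunLike.congr_fun (h1.symm.trans hcomp) (Pi.single j (1 : ℂ))
      erw [ContinuousLinearMap.zero_comp] at h2
      have h3 : (1 : ℂ) = 0 := (Pi.single_eq_same (M := fun _ : Fin n => ℂ) j 1).symm.trans h2
      exact one_ne_zero h3
    · exact absurd h0 (by simp [equation, hq])

lemma contMDiffOn_ratio (i j : Option ({x : M // x ∈ S} × Fin n)) (p : {x : M // x ∈ S}) :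
    ContMDiffOn 𝓘(ℂ, Fin n → ℂ) 𝓘(ℂ, ℂ) ω (ratio i j p : Blowup n S → ℂ)
      (coverSet i ∩ coverSet j) := by
  by_cases h : ∀ b ∈ (coverSet i ∩ coverSet j : Set (Blowup n S)), equation j p b ≠ 0
  · exact (((contMDiffOn_equation i p).mono inter_subset_left).div₀
      ((contMDiffOn_equation j p).mono inter_subset_right) h).congr fun b hb => by
        simp [ratio, h b hb]
  · push Not at h
    obtain ⟨b₀, ⟨hi, hj⟩, h0⟩ := h
    have h0' := (equation_eq_zero_iff i p b₀ hi).2 ((equation_eq_zero_iff j p b₀ hj).1 h0)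
    rcases i with _ | ⟨q, k⟩
    · exact absurd h0' one_ne_zero
    rcases j with _ | ⟨r, m⟩
    · exact absurd h0 one_ne_zero
    obtain rfl : q = p := by
      by_contra hq
      simp [equation, hq] at h0'
    obtain rfl : r = q := by
      by_contra hr
      simp [equation, hr] at h0
    refine ((contMDiffOn_excChart_comp r.1 r.2 m ((contDiff_apply ℂ ℂ k).comp
      (contDiff_update m))).mono inter_subset_right).congr ?_
    intro b hb
    have hm : b.dir r.1 m ≠ 0 := hb.2.2.1
    have h3 : Function.update (excChart n S r.1 r.2 m b) m 1 = (b.dir r.1 m)⁻¹ • b.dir r.1 :=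
      update_dirCoord m _ _ hm
    simp only [Function.comp_apply, h3, Pi.smul_apply, smul_eq_mul]
    rw [ratio]
    split_ifs with h4
    · simp [homCoord, div_eq_inv_mul]
    · simp only [equation, if_true] at h4 ⊢
      rw [mul_div_mul_left _ _ (left_ne_zero_of_mul h4), div_eq_inv_mul]

variable (n S) in
/-- The local defining functions of the exceptional divisors. -/
def exceptionalEquations :
    DefiningFunctions n (fun p : {x : M // x ∈ S} => (exceptional p : Set (Blowup n S))) where
  ι := Option ({x : M // x ∈ S} × Fin n)
  U := coverSet
  isOpen := isOpen_coverSet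
  indexAt
    | off _ _ => none
    | exc p hp l => some (⟨p, hp⟩, (exists_coord l).choose)
  mem_indexAt := by
    rintro (⟨x, hx⟩ | ⟨p, hp, l⟩)
    · exact hx
    · exact ⟨mem_chart_source _ p, (exists_coord l).choose_spec, fun _ => rfl⟩
  f := equation
  holo := contMDiffOn_equation
  eq_zero_iff := equation_eq_zero_iff
  simple := mfderiv_equation_ne_zero
  unit := ratio
  unit_holo := contMDiffOn_ratio
  eq_unit_mul i j p b hb := by
    by_cases h : equation j p b = 0
    · rw [h, mul_zero, equation_eq_zero_iff i p b hb.1, ← equation_eq_zero_iff j p b hb.2, h]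
    · simp [ratio, h]
  unit_self i p b hb := by
    by_cases h : equation i p b = 0
    · simp [ratio, h, homCoord_ne_zero i b hb]
    · simp [ratio, h]
  unit_comp i j k p b hb := by
    have hj := equation_eq_zero_iff j p b hb.1.2
    have hk := equation_eq_zero_iff k p b hb.2
    by_cases h : b ∈ exceptional p
    · simp only [ratio, hj.2 h, hk.2 h, if_true]
      exact div_mul_div_cancel₀ (homCoord_ne_zero j b hb.1.2)
    · have hj' : ¬ equation j p b = 0 := fun h' => h (hj.1 h')
      have hk' : ¬ equation k p b = 0 := fun h' => h (hk.1 h')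
      rw [ratio, ratio, ratio, if_neg hj', if_neg hk', if_neg hk']
      exact div_mul_div_cancel₀ hj'

end Blowup

end BlowingUp

end

/-! In a holomorphic frame of squared length h, the form (i/2π)Θ is positive exactly when -log h is
strictly plurisubharmonic (`isPositiveForm_curvatureForm_iff`, `HolLineBundle.isPositive_iff`), so
the whole argument concerns Levi forms. The Levi form is additive, is pulled back by holomorphic
maps (`levi_comp`), and kills log |c|² for c holomorphic without zeros (`levi_log_normSq`). Frames
therefore do not matter, and charts matter only through an injective linear map.

Take weights h of L with -log h strictly plurisubharmonic, any weights g of K, and for each centre p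
a smooth function r_p equal to |z|² near p and positive off p. Give [E_p] the metric in which the
canonical section 1 has squared length r_p. Near E_p, in the j-th affine chart, the frame has
squared length |z|²/|z_j|² = |l|²/|l_j|², which is smooth across E_p. The inverse powers give a
metric of [-∑ m_p E_p], and the form that has to be positive is k Levi(-log h) + Levi(-log g) + ∑
m_p Levi(log `divWeight` r_p).

Off the exceptional divisors this is a form on M, with log r_p in the last sum. It is not controlled
by compactness directly, because log r_p is singular at p; but near p it is log |z|², which is
plurisubharmonic, so that term only helps and may be dropped. The other terms are smooth there and
are dominated by k Levi(-log h). Compactness of M then gives one k₀ (`exists_forall_baseLevi_pos`),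
for an expression which at a point x leaves out the term centred at x itself.

At a point of E_p the terms other than the one centred at p are pulled back by dπ, whose kernel is
the tangent space of E_p and whose image is the line l. The term centred at p is the Fubini-Study
form: nonnegative, and positive on the tangent space of E_p. A vector not killed by dπ is handled by
the estimate on M at p, a nonzero vector killed by dπ by Fubini-Study (`Blowup.leviAt_weight_pos`).
Positivity is thus checked point by point on the blowup, with no uniform estimate near E_p and no
compactness of the blowup. -/

noncomputable section

/-! ### The Levi form and holomorphic maps -/

section Levi

variable {E : Type*} [NormedAddCommGroup E] [NormedSpace ℂ E] [NormedSpace ℝ E]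
  [IsScalarTower ℝ ℂ E]
  {F : Type*} [NormedAddCommGroup F] [NormedSpace ℂ F] [NormedSpace ℝ F] [IsScalarTower ℝ ℂ F]

/-- The Levi form of a real function, up to the factor `4`: the Laplacian of its restriction to the
complex line through `z` in the direction `u`. -/
def levi (φ : E → ℝ) (z u : E) : ℝ :=
  fderiv ℝ (fderiv ℝ φ) z u u + fderiv ℝ (fderiv ℝ φ) z (Complex.I • u) (Complex.I • u)

omit [IsScalarTower ℝ ℂ E] in
lemma levi_congr {φ ψ : E → ℝ} {z : E} (h : φ =ᶠ[𝓝 z] ψ) (u : E) : levi φ z u = levi ψ z u := by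
  rw [levi, levi, h.fderiv.fderiv_eq]

omit [NormedSpace ℂ E] [IsScalarTower ℝ ℂ E] in
lemma ContDiffAt.differentiableAt_fderiv_two {G : Type*} [NormedAddCommGroup G] [NormedSpace ℝ G]
    {φ : E → G} {z : E} (h : ContDiffAt ℝ 2 φ z) : DifferentiableAt ℝ (fderiv ℝ φ) z :=
  (h.fderiv_right (m := 1) (by norm_num)).differentiableAt (by norm_num)

omit [NormedSpace ℂ E] [IsScalarTower ℝ ℂ E] in
lemma ContDiffAt.eventually_differentiableAt {G : Type*} [NormedAddCommGroup G] [NormedSpace ℝ G]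
    {φ : E → G} {z : E} (h : ContDiffAt ℝ 2 φ z) : ∀ᶠ y in 𝓝 z, DifferentiableAt ℝ φ y :=
  (h.eventually (by simp)).mono fun _ hy => hy.differentiableAt (by norm_num)

omit [IsScalarTower ℝ ℂ E] in
lemma levi_add {φ ψ : E → ℝ} {z : E} (hφ : ContDiffAt ℝ 2 φ z) (hψ : ContDiffAt ℝ 2 ψ z) (u : E) :
    levi (fun y => φ y + ψ y) z u = levi φ z u + levi ψ z u := by
  have h : fderiv ℝ (fun y => φ y + ψ y) =ᶠ[𝓝 z] fun y => fderiv ℝ φ y + fderiv ℝ ψ y := by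
    filter_upwards [hφ.eventually_differentiableAt, hψ.eventually_differentiableAt] with y h1 h2
    exact fderiv_fun_add h1 h2
  simp only [levi, h.fderiv_eq,
    fderiv_fun_add hφ.differentiableAt_fderiv_two hψ.differentiableAt_fderiv_two,
    add_apply]
  ring

omit [IsScalarTower ℝ ℂ E] in
lemma levi_const (c : ℝ) (z u : E) : levi (fun _ : E => c) z u = 0 := by
  have : fderiv ℝ (fun _ : E => c) = fun _ => 0 := by ext1 y; simp
  simp [levi, this]

omit [IsScalarTower ℝ ℂ E] in
lemma levi_const_mul {φ : E → ℝ} {z : E} (hφ : ContDiffAt ℝ 2 φ z) (c : ℝ) (u : E) :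
    levi (fun y => c * φ y) z u = c * levi φ z u := by
  have h : fderiv ℝ (fun y => c * φ y) =ᶠ[𝓝 z] fun y => c • fderiv ℝ φ y := by
    filter_upwards [hφ.eventually_differentiableAt] with y h1
    exact fderiv_const_mul h1 c
  simp only [levi, h.fderiv_eq, fderiv_fun_const_smul hφ.differentiableAt_fderiv_two,
    smul_apply, smul_eq_mul]
  ring

omit [IsScalarTower ℝ ℂ E] in
lemma levi_neg {φ : E → ℝ} {z : E} (hφ : ContDiffAt ℝ 2 φ z) (u : E) :
    levi (fun y => -φ y) z u = -levi φ z u := by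
  simpa using levi_const_mul hφ (-1) u

omit [IsScalarTower ℝ ℂ E] in
lemma levi_sum {κ : Type*} (s : Finset κ) {φ : κ → E → ℝ} {z : E}
    (hφ : ∀ c ∈ s, ContDiffAt ℝ 2 (φ c) z) (u : E) :
    levi (fun y => ∑ c ∈ s, φ c y) z u = ∑ c ∈ s, levi (φ c) z u := by
  classical
  induction s using Finset.induction_on with
  | empty => simpa using levi_const 0 z u
  | insert a s ha ih =>
    simp only [Finset.sum_insert ha]
    rw [levi_add (hφ a (by simp)) (ContDiffAt.sum fun c hc => hφ c (by simp [hc])),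
      ih fun c hc => hφ c (by simp [hc])]

lemma levi_smul (φ : E → ℝ) (z u : E) (t : ℝ) : levi φ z (t • u) = t ^ 2 * levi φ z u := by
  have h : Complex.I • t • u = t • Complex.I • u := smul_comm _ _ _
  simp only [levi, h, map_smul, smul_apply, smul_eq_mul]
  ring

omit [IsScalarTower ℝ ℂ E] in
lemma levi_zero_right (φ : E → ℝ) (z : E) : levi φ z 0 = 0 := by simp [levi]

/-- The second derivative of a composition. -/
lemma fderiv_fderiv_comp {E F : Type*} [NormedAddCommGroup E] [NormedSpace ℝ E]
    [NormedAddCommGroup F] [NormedSpace ℝ F] {φ : F → ℝ} {f : E → F} {z : E}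
    (hφ : ContDiffAt ℝ 2 φ (f z)) (hf : ContDiffAt ℝ 2 f z) (u v : E) :
    fderiv ℝ (fderiv ℝ (φ ∘ f)) z u v = fderiv ℝ (fderiv ℝ φ) (f z) (fderiv ℝ f z u)
      (fderiv ℝ f z v) + fderiv ℝ φ (f z) (fderiv ℝ (fderiv ℝ f) z u v) := by
  have h : fderiv ℝ (φ ∘ f) =ᶠ[𝓝 z] fun y => (fderiv ℝ φ (f y)).comp (fderiv ℝ f y) := by
    filter_upwards [hf.eventually_differentiableAt,
      hf.continuousAt.eventually hφ.eventually_differentiableAt] with y h1 h2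
    exact fderiv_comp y h2 h1
  have h1 : HasFDerivAt (fun y => fderiv ℝ φ (f y))
      ((fderiv ℝ (fderiv ℝ φ) (f z)).comp (fderiv ℝ f z)) z :=
    hφ.differentiableAt_fderiv_two.hasFDerivAt.comp z
      (hf.differentiableAt (by norm_num)).hasFDerivAt
  have h2 := h1.clm_comp hf.differentiableAt_fderiv_two.hasFDerivAt
  rw [h.fderiv_eq, h2.fderiv]
  simp [add_comm]

lemma fderiv_real_I_smul {f : E → F} {z : E} (hf : DifferentiableAt ℂ f z) (u : E) :
    fderiv ℝ f z (Complex.I • u) = Complex.I • fderiv ℝ f z u := by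
  rw [hf.fderiv_restrictScalars ℝ]
  simp

/-- The second derivative of a holomorphic map is complex bilinear. -/
lemma fderiv_fderiv_I_smul {f : E → F} {z : E} (hf : ContDiffAt ℂ 2 f z) (u : E) :
    fderiv ℝ (fderiv ℝ f) z (Complex.I • u) (Complex.I • u) = -fderiv ℝ (fderiv ℝ f) z u u := by
  have h : fderiv ℝ f =ᶠ[𝓝 z] fun y => (fderiv ℂ f y).restrictScalars ℝ := by
    filter_upwards [hf.eventually (by simp)] with y hy
    exact (hy.differentiableAt (by norm_num)).fderiv_restrictScalars ℝ
  have h1 : HasFDerivAt (fderiv ℂ f) (fderiv ℂ (fderiv ℂ f) z) z :=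
    ((hf.fderiv_right (m := 1) (by norm_num)).differentiableAt (by norm_num)).hasFDerivAt
  have h2 : HasFDerivAt (fun y => (fderiv ℂ f y).restrictScalars ℝ)
      ((ContinuousLinearMap.restrictScalarsL ℂ E F ℝ ℝ).comp
        ((fderiv ℂ (fderiv ℂ f) z).restrictScalars ℝ)) z :=
    (ContinuousLinearMap.restrictScalarsL ℂ E F ℝ ℝ).hasFDerivAt.comp z (h1.restrictScalars ℝ)
  rw [h.fderiv_eq, h2.fderiv]
  simp [smul_smul]

/-- The Levi form is invariant under holomorphic maps. -/
lemma levi_comp {φ : F → ℝ} {f : E → F} {z : E} (hφ : ContDiffAt ℝ 2 φ (f z))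
    (hf : ContDiffAt ℂ 2 f z) (u : E) :
    levi (φ ∘ f) z u = levi φ (f z) (fderiv ℝ f z u) := by
  have hr : ContDiffAt ℝ 2 f z := hf.restrict_scalars ℝ
  -- The terms Dφ(D²f(u, u)) and Dφ(D²f(iu, iu)) cancel, because D²f is complex bilinear.
  rw [levi, levi, fderiv_fderiv_comp hφ hr, fderiv_fderiv_comp hφ hr, fderiv_fderiv_I_smul hf,
    fderiv_real_I_smul (hf.differentiableAt (by norm_num)), map_neg]
  ring

/-- The function is the pullback along f of the real linear function Re on ℂ, whose second
derivative vanishes. -/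
lemma levi_re {f : E → ℂ} {z : E} (hf : ContDiffAt ℂ 2 f z) (u : E) :
    levi (fun y => (f y).re) z u = 0 := by
  have h := levi_comp (φ := fun w : ℂ => w.re) (f := f) (z := z)
    Complex.reCLM.contDiff.contDiffAt hf u
  have h0 : fderiv ℝ (fun w : ℂ => w.re) = fun _ => Complex.reCLM := by
    ext1 y; exact Complex.reCLM.fderiv
  have h1 : levi (fun w : ℂ => w.re) (f z) (fderiv ℝ f z u) = 0 := by
    simp [levi, h0]
  rw [← h1, ← h]
  rfl

/-- Locally log |f|² is a constant plus the real part of 2 log(f / f z). Dividing by the constant f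
z brings the argument near 1, away from the branch cut. -/
lemma levi_log_normSq {f : E → ℂ} {z : E} (hf : ContDiffAt ℂ 2 f z) (h0 : f z ≠ 0) (u : E) :
    levi (fun y => Real.log (‖f y‖ ^ 2)) z u = 0 := by
  have hq : ContDiffAt ℂ 2 (fun y => f y / f z) z := hf.div_const _
  have hmem : f z / f z ∈ Complex.slitPlane := by rw [div_self h0]; simp
  have h1 : ContDiffAt ℂ 2 (fun y => 2 * Complex.log (f y / f z)) z :=
    contDiffAt_const.mul (ContDiffAt.comp (g := Complex.log) z (Complex.contDiffAt_log hmem) hq)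
  have h2 : (fun y => Real.log (‖f y‖ ^ 2)) =ᶠ[𝓝 z]
      fun y => (2 * Complex.log (f y / f z)).re + Real.log (‖f z‖ ^ 2) := by
    filter_upwards [hf.continuousAt.eventually_ne h0] with y hy
    have h3 := norm_pos_iff.2 hy
    have h4 := norm_pos_iff.2 h0
    simp only [Complex.mul_re, Complex.re_ofNat, Complex.im_ofNat, zero_mul, sub_zero,
      Complex.log_re, norm_div, Real.log_pow, Real.log_div h3.ne' h4.ne']
    push_cast
    ring
  have h3 : ContDiffAt ℝ 2 (fun y => (2 * Complex.log (f y / f z)).re) z :=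
    Complex.reCLM.contDiff.contDiffAt.comp z (h1.restrict_scalars ℝ)
  rw [levi_congr h2, levi_add h3 contDiffAt_const, levi_re h1, levi_const, add_zero]

end Levi

/-! ### Domination of one quadratic form by large multiples of another -/

section Domination

/-- If `A` is positive definite at `z₀`, large multiples of `A` dominate `B` near `z₀`. -/
lemma exists_forall_mul_add_pos {E : Type*} [NormedAddCommGroup E] [NormedSpace ℝ E]
    [FiniteDimensional ℝ E] {A B : E → E → ℝ} {O : Set E} (hO : IsOpen O) {z₀ : E} (hz₀ : z₀ ∈ O)
    (hA : ContinuousOn (fun q : E × E => A q.1 q.2) (O ×ˢ univ))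
    (hB : ContinuousOn (fun q : E × E => B q.1 q.2) (O ×ˢ univ))
    (hA2 : ∀ z u, ∀ t : ℝ, A z (t • u) = t ^ 2 * A z u)
    (hB2 : ∀ z u, ∀ t : ℝ, B z (t • u) = t ^ 2 * B z u)
    (hpos : ∀ u, u ≠ 0 → 0 < A z₀ u) :
    ∃ k₀ : ℕ, ∀ᶠ z in 𝓝 z₀, ∀ k : ℕ, k₀ ≤ k → ∀ u, u ≠ 0 → 0 < k * A z u + B z u := by
  have : ProperSpace E := FiniteDimensional.proper ℝ E
  -- Both forms are homogeneous of degree two, so unit vectors suffice, and these form a compact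
  -- set.
  set K := Metric.sphere (0 : E) 1
  have hK : IsCompact K := isCompact_sphere 0 1
  have hopen : IsOpen ((O ×ˢ univ) ∩ (fun q : E × E => A q.1 q.2) ⁻¹' Ioi 0) :=
    hA.isOpen_inter_preimage (hO.prod isOpen_univ) isOpen_Ioi
  obtain ⟨V, W, hV, hW, hzV, hKW, hVW⟩ := generalized_tube_lemma (isCompact_singleton (x := z₀)) hK
    hopen (by
      rintro ⟨z, u⟩ ⟨rfl, hu⟩
      exact ⟨⟨hz₀, trivial⟩, hpos u (ne_zero_of_mem_unit_sphere ⟨u, hu⟩)⟩)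
  obtain ⟨C, hC, hCV⟩ := exists_compact_subset hV (hzV rfl)
  have hsub : C ×ˢ K ⊆ (O ×ˢ univ) ∩ (fun q : E × E => A q.1 q.2) ⁻¹' Ioi 0 := fun q hq =>
    hVW ⟨hCV.2 hq.1, hKW hq.2⟩
  have hdiv : ContinuousOn (fun q : E × E => -B q.1 q.2 / A q.1 q.2) (C ×ˢ K) :=
    (hB.mono fun q hq => (hsub hq).1).neg.div (hA.mono fun q hq => (hsub hq).1)
      fun q hq => (hsub hq).2.ne'
  -- Since A > 0 on the compact set C × K, the inequality kA + B > 0 there says that k exceeds -B/A,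
  -- which is bounded by c.
  obtain ⟨c, hc⟩ := (hC.prod hK).bddAbove_image hdiv
  obtain ⟨k₀, hk₀⟩ := exists_nat_gt c
  refine ⟨k₀, Filter.mem_of_superset (mem_interior_iff_mem_nhds.1 hCV.1) ?_⟩
  intro z hz k hk u hu
  have hn : 0 < ‖u‖ := norm_pos_iff.2 hu
  have hv : ‖u‖⁻¹ • u ∈ K := by simp [K, norm_smul, hn.ne']
  have h1 := (hsub (⟨hz, hv⟩ : (z, ‖u‖⁻¹ • u) ∈ C ×ˢ K)).2
  have h2 := hc (mem_image_of_mem _ (⟨hz, hv⟩ : (z, ‖u‖⁻¹ • u) ∈ C ×ˢ K))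
  simp only [mem_preimage, mem_Ioi] at h1 h2
  have h3 : -B z (‖u‖⁻¹ • u) / A z (‖u‖⁻¹ • u) < k :=
    (h2.trans_lt hk₀).trans_le (by exact_mod_cast hk)
  rw [div_lt_iff₀ h1, hA2, hB2] at h3
  have h4 : 0 < ‖u‖⁻¹ ^ 2 := by positivity
  have h5 : 0 < ‖u‖⁻¹ ^ 2 * (k * A z u + B z u) := by linarith
  exact pos_of_mul_pos_right h5 h4.le

end Domination

/-! ### The Levi form of log |z|², that is, the Fubini-Study form -/

section LogNorm

variable {E : Type*} [NormedAddCommGroup E] [InnerProductSpace ℂ E]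
  [InnerProductSpace ℝ E]

/-- The first derivative of log ‖x‖² is 2‖x‖⁻² Re⟨x, ·⟩. Differentiating again and adding the values
at v and iv, the squares of Re⟨z, v⟩ and Re⟨z, iv⟩ = -Im⟨z, v⟩ combine to |⟨z, v⟩|². The real inner
product is an independent structure, tied to the complex one by `h4`. -/
lemma levi_log_norm_sq (h4 : ∀ x y : E, inner ℝ x y = (inner ℂ x y).re) {z : E} (hz : z ≠ 0) (v : E) :
    levi (fun x : E => Real.log (‖x‖ ^ 2)) z v =
      4 * (‖z‖ ^ 2 * ‖v‖ ^ 2 - ‖inner ℂ z v‖ ^ 2) / ‖z‖ ^ 4 := by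
  have hd : ∀ x : E, HasFDerivAt (fun x : E => ‖x‖ ^ 2) (2 • innerSL ℝ x) x := fun x =>
    (hasStrictFDerivAt_norm_sq x).hasFDerivAt
  have hlog : ∀ x : E, x ≠ 0 → HasFDerivAt (fun x : E => Real.log (‖x‖ ^ 2))
      ((‖x‖ ^ 2)⁻¹ • 2 • innerSL ℝ x) x := fun x hx =>
    (hd x).log (pow_ne_zero 2 (norm_ne_zero_iff.2 hx))
  have h1 : fderiv ℝ (fun x : E => Real.log (‖x‖ ^ 2)) =ᶠ[𝓝 z]
      fun x => (‖x‖ ^ 2)⁻¹ • (2 • innerSL ℝ : E →L[ℝ] E →L[ℝ] ℝ) x := by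
    filter_upwards [isOpen_ne.mem_nhds hz] with x hx
    exact (hlog x hx).fderiv
  have hn : ‖z‖ ≠ 0 := norm_ne_zero_iff.2 hz
  have h2 := ((hasDerivAt_inv (pow_ne_zero 2 hn)).comp_hasFDerivAt z (hd z)).fun_smul
    ((2 • innerSL ℝ : E →L[ℝ] E →L[ℝ] ℝ).hasFDerivAt (x := z))
  simp only [Function.comp_def] at h2
  have h3 : ‖inner ℂ z v‖ ^ 2 = (inner ℂ z v).re ^ 2 + (inner ℂ z v).im ^ 2 := by
    rw [← Complex.normSq_eq_norm_sq, Complex.normSq_apply]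
    ring
  have h5 : inner ℝ v v = ‖v‖ ^ 2 := real_inner_self_eq_norm_sq v
  have h6 : inner ℝ (Complex.I • v) (Complex.I • v) = ‖v‖ ^ 2 := by
    rw [real_inner_self_eq_norm_sq, norm_smul]
    simp
  have h7 : inner ℝ z (Complex.I • v) = -(inner ℂ z v).im := by
    rw [h4, inner_smul_right]
    simp
  rw [levi, h1.fderiv_eq, h2.fderiv, h3]
  have h8 : ∀ x y : E, innerSL ℝ x y = inner ℝ x y := fun x y => rfl
  simp only [add_apply, smul_apply, ContinuousLinearMap.smulRight_apply, h8,
    h5, h6, h7, h4 z v, nsmul_eq_mul, smul_eq_mul]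
  field_simp
  ring

end LogNorm

section NormSq

variable {n : ℕ}

/-- The square of the Euclidean norm on `ℂⁿ`. -/
def euclSq (d : Fin n → ℂ) : ℝ := ∑ i, ‖d i‖ ^ 2

lemma euclSq_eq_norm (d : Fin n → ℂ) : euclSq d = ‖WithLp.toLp 2 d‖ ^ 2 := by
  rw [EuclideanSpace.norm_sq_eq]
  rfl

lemma euclSq_pos {d : Fin n → ℂ} (hd : d ≠ 0) : 0 < euclSq d := by
  rw [euclSq_eq_norm]
  have : WithLp.toLp 2 d ≠ 0 := by simpa using hd
  positivity

lemma euclSq_smul (c : ℂ) (d : Fin n → ℂ) : euclSq (c • d) = ‖c‖ ^ 2 * euclSq d := by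
  simp [euclSq, Finset.mul_sum, mul_pow]

lemma contDiff_euclSq {k : WithTop ℕ∞} : ContDiff ℝ k (euclSq : (Fin n → ℂ) → ℝ) :=
  ContDiff.sum fun i _ => (contDiff_apply ℝ ℂ i).norm_sq ℝ

/-- The type `Fin n → ℂ` carries the sup norm, so the formula for inner product spaces is
transported along the linear isomorphism onto `EuclideanSpace ℂ (Fin n)`. -/
lemma levi_log_euclSq {d : Fin n → ℂ} (hd : d ≠ 0) (v : Fin n → ℂ) :
    levi (fun y => Real.log (euclSq y)) d v =
      4 * (‖WithLp.toLp 2 d‖ ^ 2 * ‖WithLp.toLp 2 v‖ ^ 2 -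
        ‖inner ℂ (WithLp.toLp 2 d) (WithLp.toLp 2 v)‖ ^ 2) / ‖WithLp.toLp 2 d‖ ^ 4 := by
  have hd' : WithLp.toLp 2 d ≠ 0 := by simpa using hd
  have hre : ∀ x y : EuclideanSpace ℂ (Fin n), inner ℝ x y = (inner ℂ x y).re := fun x y => by
    simp only [PiLp.inner_apply, Complex.re_sum]
    rfl
  let T : (Fin n → ℂ) →L[ℂ] EuclideanSpace ℂ (Fin n) :=
    (PiLp.continuousLinearEquiv 2 ℂ fun _ : Fin n => ℂ).symm.toContinuousLinearMap
  have hT : ∀ y, T y = WithLp.toLp 2 y := fun y => rfl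
  have h := levi_comp (φ := fun x : EuclideanSpace ℂ (Fin n) => Real.log (‖x‖ ^ 2)) (f := T)
    (z := d) ((contDiff_norm_sq ℝ).contDiffAt.log
      (pow_ne_zero 2 (norm_ne_zero_iff.2 hd'))) T.contDiff.contDiffAt v
  have hder : fderiv ℝ T d v = WithLp.toLp 2 v := by
    rw [T.differentiableAt.fderiv_restrictScalars ℝ, T.fderiv]
    rfl
  rw [hder, hT, levi_log_norm_sq hre hd'] at h
  rw [← h]
  congr 1
  ext1 y
  rw [euclSq_eq_norm]
  rfl

/-- This is the Cauchy-Schwarz inequality; its equality case is the next lemma. -/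
lemma levi_log_euclSq_nonneg {d : Fin n → ℂ} (hd : d ≠ 0) (v : Fin n → ℂ) :
    0 ≤ levi (fun y => Real.log (euclSq y)) d v := by
  rw [levi_log_euclSq hd]
  have h := norm_inner_le_norm (𝕜 := ℂ) (WithLp.toLp 2 d) (WithLp.toLp 2 v)
  have h2 := pow_le_pow_left₀ (norm_nonneg _) h 2
  rw [mul_pow] at h2
  have : 0 ≤ ‖WithLp.toLp 2 d‖ ^ 2 * ‖WithLp.toLp 2 v‖ ^ 2 -
        ‖inner ℂ (WithLp.toLp 2 d) (WithLp.toLp 2 v)‖ ^ 2 := by linarith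
  positivity

/-- The Levi form of the logarithm of the Euclidean norm is degenerate only along the complex
line through the point. -/
lemma exists_smul_of_levi_log_euclSq_eq_zero {d v : Fin n → ℂ} (hd : d ≠ 0)
    (h : levi (fun y => Real.log (euclSq y)) d v = 0) : ∃ c : ℂ, v = c • d := by
  by_cases hv : v = 0
  · exact ⟨0, by simp [hv]⟩
  have hd' : WithLp.toLp 2 d ≠ 0 := by simpa using hd
  have hv' : WithLp.toLp 2 v ≠ 0 := by simpa using hv
  have hn : ‖WithLp.toLp 2 d‖ ≠ 0 := norm_ne_zero_iff.2 hd'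
  rw [levi_log_euclSq hd, div_eq_zero_iff, or_iff_left (pow_ne_zero 4 hn), mul_eq_zero,
    or_iff_right four_ne_zero, sub_eq_zero, ← mul_pow, eq_comm,
    pow_left_inj₀ (norm_nonneg _) (by positivity) two_ne_zero,
    norm_inner_eq_norm_iff hd' hv'] at h
  obtain ⟨r, -, hr⟩ := h
  exact ⟨r, by simpa using congrArg WithLp.ofLp hr⟩

end NormSq

/-! ### Curvature as a Levi form -/

section CurvatureLevi

variable {n : ℕ}

/-- The curvature form in terms of the second derivative of the weight. -/
lemma curvatureForm_eq {h : (Fin n → ℂ) → ℝ} {z : Fin n → ℂ} (hh : ContDiffAt ℝ 2 h z)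
    (h0 : 0 < h z) (u v : Fin n → ℂ) :
    curvatureForm h z u v = Complex.I / 2 *
      ((fderiv ℝ (fderiv ℝ fun y => Real.log (h y)) z v (Complex.I • u) -
        fderiv ℝ (fderiv ℝ fun y => Real.log (h y)) z u (Complex.I • v) : ℝ) : ℂ) := by
  set φ : (Fin n → ℂ) → ℝ := fun y => Real.log (h y) with hφ
  have hφ2 : ContDiffAt ℝ 2 φ z := hh.log h0.ne'
  have hsymm : IsSymmSndFDerivAt ℝ φ z := hφ2.isSymmSndFDerivAt (by simp)
  -- The connection form is ∂ log h. The identity is used twice: evaluated at a vector, to compute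
  -- the derivative, and between operator-valued maps (`hchern`), to know that the derivative
  -- exists.
  have hev : ∀ w, (fun y => chernForm h y w) =ᶠ[𝓝 z]
      fun y => (1 / 2 : ℂ) * ((fderiv ℝ φ y w : ℂ) - Complex.I * fderiv ℝ φ y (Complex.I • w)) := by
    intro w
    filter_upwards [hh.eventually_differentiableAt,
      hh.continuousAt.eventually (isOpen_Ioi.mem_nhds h0)] with y hy hpos
    have hpos' : (h y : ℂ) ≠ 0 := by exact_mod_cast (ne_of_gt hpos)
    rw [chernForm_apply, hφ, fderiv.log hy (ne_of_gt hpos)]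
    simp only [smul_apply, smul_eq_mul]
    push_cast
    field_simp
  have hchern : chernForm h =ᶠ[𝓝 z] fun y => (1 / 2 : ℂ) • (Complex.ofRealCLM ∘L fderiv ℝ φ y -
      Complex.I • (Complex.ofRealCLM ∘L fderiv ℝ φ y ∘L
        (Complex.I • ContinuousLinearMap.id ℂ (Fin n → ℂ)).restrictScalars ℝ)) := by
    filter_upwards [hh.eventually_differentiableAt,
      hh.continuousAt.eventually (isOpen_Ioi.mem_nhds h0)] with y hy hpos
    have hpos' : (h y : ℂ) ≠ 0 := by exact_mod_cast (ne_of_gt hpos)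
    ext w
    rw [chernForm_apply, hφ, fderiv.log hy (ne_of_gt hpos)]
    simp only [smul_apply, smul_eq_mul, sub_apply, ContinuousLinearMap.comp_apply,
      Complex.ofRealCLM_apply, ContinuousLinearMap.coe_restrictScalars',
      ContinuousLinearMap.id_apply]
    push_cast
    field_simp
  have hd := hφ2.differentiableAt_fderiv_two
  have hdiff : DifferentiableAt ℝ (chernForm h) z := by
    refine DifferentiableAt.congr_of_eventuallyEq ?_ hchern
    fun_prop
  have key : ∀ a w, fderiv ℝ (chernForm h) z a w = (1 / 2 : ℂ) *
      ((fderiv ℝ (fderiv ℝ φ) z a w : ℂ) -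
        Complex.I * fderiv ℝ (fderiv ℝ φ) z a (Complex.I • w)) := by
    intro a w
    have h1 : fderiv ℝ (chernForm h) z a w = fderiv ℝ (fun y => chernForm h y w) z a := by
      rw [fderiv_clm_apply hdiff (differentiableAt_const w)]
      simp
    have h2 : ∀ w, HasFDerivAt (fun y => (fderiv ℝ φ y w : ℂ))
        (Complex.ofRealCLM ∘L (fderiv ℝ (fderiv ℝ φ) z).flip w) z := fun w => by
      have := hd.hasFDerivAt.clm_apply (hasFDerivAt_const w z)
      rw [ContinuousLinearMap.comp_zero, zero_add] at this
      exact Complex.ofRealCLM.hasFDerivAt.comp z this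
    have h3 := ((h2 w).fun_sub ((h2 (Complex.I • w)).const_mul Complex.I)).const_mul (1 / 2 : ℂ)
    rw [h1, (hev w).fderiv_eq, h3.fderiv]
    simp
  -- The terms D²φ(u, v) and D²φ(v, u) cancel by symmetry, leaving those that contain i.
  rw [curvatureForm, key, key, hsymm u v]
  push_cast
  ring

/-- The curvature form of a Hermitian metric with weight `h` is positive if and only if `-log h` is
strictly plurisubharmonic. -/
lemma isPositiveForm_curvatureForm_iff {h : (Fin n → ℂ) → ℝ} {z : Fin n → ℂ}
    (hh : ContDiffAt ℝ 2 h z) (h0 : 0 < h z) :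
    IsPositiveForm (fun u v => Complex.I / (2 * Real.pi) * curvatureForm h z u v) ↔
      ∀ u, u ≠ 0 → 0 < levi (fun y => -Real.log (h y)) z u := by
  set D := fderiv ℝ (fderiv ℝ fun y => Real.log (h y)) z with hD
  have hpi : (Real.pi : ℂ) ≠ 0 := by exact_mod_cast Real.pi_ne_zero
  -- The form is real, and at (u, iu) it is (4π)⁻¹ times the Levi form of -log h, since i · iu = -u.
  have key : ∀ u v, Complex.I / (2 * Real.pi) * curvatureForm h z u v =
      (((4 * Real.pi)⁻¹ * (D u (Complex.I • v) - D v (Complex.I • u)) : ℝ) : ℂ) := by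
    intro u v
    rw [curvatureForm_eq hh h0, ← hD]
    push_cast
    field_simp
    rw [Complex.I_sq]
    ring
  have hI : ∀ u : Fin n → ℂ, Complex.I • Complex.I • u = -u := fun u => by
    rw [smul_smul, Complex.I_mul_I, neg_one_smul]
  have hlevi : ∀ u, levi (fun y => -Real.log (h y)) z u =
      -(D u u + D (Complex.I • u) (Complex.I • u)) := fun u => levi_neg (hh.log h0.ne') u
  have hsymm : ∀ u v, D u v = D v u := (hh.log h0.ne').isSymmSndFDerivAt (by simp)
  simp only [IsPositiveForm, key, Complex.ofReal_im, Complex.ofReal_re, hI, hlevi, map_neg,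
    implies_true, true_and]
  constructor
  · rintro ⟨-, h2⟩ u hu
    have h3 := pos_of_mul_pos_right (h2 u hu) (by positivity)
    linarith
  · intro h2
    refine ⟨fun u v => ?_, fun u hu => mul_pos (by positivity) (by linarith [h2 u hu])⟩
    -- Type (1,1) is automatic from the symmetry of the second derivative.
    rw [hsymm (Complex.I • u) v, hsymm (Complex.I • v) u]
    ring_nf

end CurvatureLevi

/-! ### The underlying real manifold and change of charts -/

section RealStructure

variable {E F : Type*} [NormedAddCommGroup E] [NormedSpace ℂ E] [NormedSpace ℝ E]
  [IsScalarTower ℝ ℂ E] [NormedAddCommGroup F] [NormedSpace ℂ F] [NormedSpace ℝ F]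
  [IsScalarTower ℝ ℂ F] {X Y : Type*} [TopologicalSpace X] [ChartedSpace E X]
  [TopologicalSpace Y] [ChartedSpace F Y]

/-- Holomorphic maps are smooth for the underlying real structures. -/
lemma ContMDiffOn.real_of_complex {f : X → Y} {s : Set X}
    (hf : ContMDiffOn 𝓘(ℂ, E) 𝓘(ℂ, F) ω f s) : ContMDiffOn 𝓘(ℝ, E) 𝓘(ℝ, F) ∞ f s := by
  intro x hx
  have h := contMDiffWithinAt_iff.1 (hf x hx)
  exact contMDiffWithinAt_iff.2 ⟨h.1, (h.2.restrict_scalars ℝ).of_le le_top⟩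

lemma ContMDiff.real_of_complex {f : X → Y} (hf : ContMDiff 𝓘(ℂ, E) 𝓘(ℂ, F) ω f) :
    ContMDiff 𝓘(ℝ, E) 𝓘(ℝ, F) ∞ f :=
  contMDiffOn_univ.1 hf.contMDiffOn.real_of_complex

variable (E X) in
/-- The real manifold underlying a complex manifold. -/
lemma isManifold_real [IsManifold 𝓘(ℂ, E) ω X] : IsManifold 𝓘(ℝ, E) ∞ X := by
  refine isManifold_of_contDiffOn _ _ _ fun e e' he he' => ?_
  have h := (contDiffGroupoid ω 𝓘(ℂ, E)).compatible he he'
  rw [contDiffGroupoid, mem_groupoid_of_pregroupoid] at h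
  exact (ContDiffOn.restrict_scalars ℝ h.1).of_le le_top

omit [NormedSpace ℂ E] [IsScalarTower ℝ ℂ E] in
lemma ContMDiffAt.contDiffAt_chart {f : X → ℝ} {x : X} (hf : ContMDiffAt 𝓘(ℝ, E) 𝓘(ℝ, ℝ) ∞ f x) :
    ContDiffAt ℝ 2 (fun z => f ((chartAt E x).symm z)) (chartAt E x x) := by
  have h := (contMDiffAt_iff.1 hf).2
  simp only [modelWithCornersSelf_coe, range_id, contDiffWithinAt_univ] at h
  exact h.of_le (by norm_cast)

omit [NormedSpace ℂ E] [IsScalarTower ℝ ℂ E] in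
lemma ContMDiffAt.contDiffAt_chart_of_mem_source [IsManifold 𝓘(ℝ, E) ∞ X] {f : X → ℝ} {x y : X}
    (hf : ContMDiffAt 𝓘(ℝ, E) 𝓘(ℝ, ℝ) ∞ f y) (hy : y ∈ (chartAt E x).source) :
    ContDiffAt ℝ 2 (fun z => f ((chartAt E x).symm z)) (chartAt E x y) := by
  have h1 : ContMDiffAt 𝓘(ℝ, E) 𝓘(ℝ, E) ∞ (chartAt E x).symm (chartAt E x y) :=
    (contMDiffOn_chart_symm (I := 𝓘(ℝ, E)) (n := ∞) (x := x)).contMDiffAt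
      ((chartAt E x).open_target.mem_nhds ((chartAt E x).map_source hy))
  have h2 : ContMDiffAt 𝓘(ℝ, E) 𝓘(ℝ, ℝ) ∞ f ((chartAt E x).symm (chartAt E x y)) := by
    rwa [(chartAt E x).left_inv hy]
  exact (h2.comp (chartAt E x y) h1).contDiffAt.of_le (by norm_cast)

/-- The Levi form in one chart is a pullback of the Levi form in another chart. -/
lemma exists_levi_chart_eq [IsManifold 𝓘(ℂ, E) ω X] {x y : X} (hy : y ∈ (chartAt E x).source) :
    ∃ T : E → E, (∀ u, T u = 0 → u = 0) ∧ ∀ f : X → ℝ, ContMDiffAt 𝓘(ℝ, E) 𝓘(ℝ, ℝ) ∞ f y → ∀ u,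
      levi (fun z => f ((chartAt E y).symm z)) (chartAt E y y) u =
        levi (fun z => f ((chartAt E x).symm z)) (chartAt E x y) (T u) := by
  have := isManifold_real E X
  set c : E → E := fun z => chartAt E x ((chartAt E y).symm z) with hc
  set d : E → E := fun z => chartAt E y ((chartAt E x).symm z) with hd
  have hyy : (chartAt E y).symm (chartAt E y y) = y := (chartAt E y).left_inv (mem_chart_source E y)
  have hxy : (chartAt E x).symm (chartAt E x y) = y := (chartAt E x).left_inv hy
  have key : ∀ a b : X, y ∈ (chartAt E a).source → y ∈ (chartAt E b).source →
      ContDiffAt ℂ 2 (fun z => chartAt E b ((chartAt E a).symm z)) (chartAt E a y) := by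
    intro a b ha hb
    have h1 : ContMDiffAt 𝓘(ℂ, E) 𝓘(ℂ, E) ω (chartAt E a).symm (chartAt E a y) :=
      (contMDiffOn_chart_symm (I := 𝓘(ℂ, E)) (n := ω) (x := a)).contMDiffAt
        ((chartAt E a).open_target.mem_nhds ((chartAt E a).map_source ha))
    have h2 : ContMDiffAt 𝓘(ℂ, E) 𝓘(ℂ, E) ω (chartAt E b)
        ((chartAt E a).symm (chartAt E a y)) := by
      rw [(chartAt E a).left_inv ha]
      exact (contMDiffOn_chart (I := 𝓘(ℂ, E)) (n := ω) (x := b)).contMDiffAt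
        ((chartAt E b).open_source.mem_nhds hb)
    exact (h2.comp (chartAt E a y) h1).contDiffAt.of_le le_top
  have hcc := key y x (mem_chart_source E y) hy
  have hdd := key x y hy (mem_chart_source E y)
  have hcy : c (chartAt E y y) = chartAt E x y := by rw [hc]; simp only [hyy]
  have hmem : ∀ᶠ z in 𝓝 (chartAt E y y), (chartAt E y).symm z ∈ (chartAt E x).source ∧
      z ∈ (chartAt E y).target := by
    refine Filter.Eventually.and ?_ ((chartAt E y).open_target.mem_nhds (mem_chart_target E y))
    refine ((chartAt E y).continuousAt_symm (mem_chart_target E y)).eventually ?_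
    rw [hyy]
    exact (chartAt E x).open_source.mem_nhds hy
  -- The map T is the differential of the coordinate change c, injective because d ∘ c is the
  -- identity near the point. It does not depend on f, so one T serves for several functions at
  -- once.
  refine ⟨fderiv ℝ c (chartAt E y y), fun u hu => ?_, fun f hf u => ?_⟩
  · have h1 : HasFDerivAt (d ∘ c) ((fderiv ℝ d (chartAt E x y)).comp (fderiv ℝ c (chartAt E y y)))
        (chartAt E y y) := by
      refine HasFDerivAt.comp _ ?_ ((hcc.restrict_scalars ℝ).differentiableAt
        (by norm_num)).hasFDerivAt
      rw [hcy]
      exact ((hdd.restrict_scalars ℝ).differentiableAt (by norm_num)).hasFDerivAt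
    have h2 : d ∘ c =ᶠ[𝓝 (chartAt E y y)] id := by
      filter_upwards [hmem] with z hz
      simp only [hc, hd, Function.comp_apply, (chartAt E x).left_inv hz.1,
        (chartAt E y).right_inv hz.2, id]
    have h3 := (h1.congr_of_eventuallyEq h2.symm).unique (hasFDerivAt_id _)
    have h4 := DFunLike.congr_fun h3 u
    simpa [hu] using h4.symm
  · have hf2 := hf.contDiffAt_chart_of_mem_source hy
    rw [← hcy] at hf2 ⊢
    rw [← levi_comp (φ := fun z => f ((chartAt E x).symm z)) (f := c) hf2 hcc]
    refine levi_congr ?_ u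
    filter_upwards [hmem] with z hz
    simp only [hc, Function.comp_apply, (chartAt E x).left_inv hz.1]

end RealStructure

/-! ### Hermitian metrics as families of positive weights -/

lemma InnerProductSpace.Core.re_inner_smul_smul {V : Type*} [AddCommGroup V] [Module ℂ V]
    (C : InnerProductSpace.Core ℂ V) (r : ℂ) (v : V) :
    (C.inner (r • v) (r • v)).re = ‖r‖ ^ 2 * (C.inner v v).re := by
  rw [C.smul_left, ← C.conj_inner_symm, C.smul_left, map_mul, C.conj_inner_symm,
    Complex.conj_conj, ← mul_assoc, ← Complex.normSq_eq_conj_mul_self, Complex.re_ofReal_mul,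
    Complex.normSq_eq_norm_sq]

namespace HolLineBundle

variable {n : ℕ} {X : Type*} [TopologicalSpace X] [ChartedSpace (Fin n → ℂ) X]

/-- The squared lengths of the frames of a line bundle in some Hermitian metric. -/
structure IsMetricWeight (L : HolLineBundle n X) (h : L.ι → X → ℝ) : Prop where
  pos : ∀ i, ∀ x ∈ L.dom i, 0 < h i x
  smooth : ∀ i, ContMDiffOn 𝓘(ℝ, Fin n → ℂ) 𝓘(ℝ, ℝ) ∞ (h i) (L.dom i)
  trans : ∀ i j, ∀ x ∈ L.dom i ∩ L.dom j, h i x = ‖L.trans i j x‖ ^ 2 * h j x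

lemma isOpen_dom (L : HolLineBundle n X) (i : L.ι) : IsOpen (L.dom i) := L.core.isOpen_baseSet i

lemma trans_ne_zero (L : HolLineBundle n X) (i j : L.ι) {x : X} (hx : x ∈ L.dom i ∩ L.dom j) :
    L.trans i j x ≠ 0 := fun h => by
  have := L.trans_comp i j i x ⟨hx, hx.1⟩
  rw [h, mul_zero, L.trans_self i x hx.1] at this
  exact zero_ne_one this

/-- Vectors of the fibre at x are recorded in the trivialization `indexAt x`, so the frame of the
i-th one appears there as a transition function. -/
lemma localTriv_symm_one (L : HolLineBundle n X) (i : L.ι) {x : X} (hx : x ∈ L.dom i) :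
    (L.core.localTriv i).symm x (1 : ℂ) = L.trans i (L.core.indexAt x) x :=
  VectorBundleCore.localTriv_symm_apply L.core i hx 1

/-- Together with the converse `IsMetricWeight.metric`, this replaces metrics by families of
functions, on which tensor powers, tensor products and pullbacks act as powers, products and
composition. -/
lemma HermitianMetric.isMetricWeight {L : HolLineBundle n X} (H : L.HermitianMetric) :
    L.IsMetricWeight H.normSq where
  smooth := H.smooth
  pos i x hx := by
    let cd : PreInnerProductSpace.Core ℂ (L.core.Fiber x) := (H.inner x).toCore
    rw [HermitianMetric.normSq, localTriv_symm_one L i hx]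
    refine lt_of_le_of_ne ((H.inner x).re_inner_nonneg _) fun h => ?_
    refine L.trans_ne_zero i (L.core.indexAt x) ⟨hx, L.core.mem_baseSet_at x⟩
      ((H.inner x).definite _ ?_)
    -- Conjugate symmetry makes ⟨v, v⟩ real, so a vanishing real part forces ⟨v, v⟩ = 0.
    have him := (H.inner x).conj_inner_symm (L.trans i (L.core.indexAt x) x)
      (L.trans i (L.core.indexAt x) x)
    exact Complex.ext h.symm (Complex.conj_eq_iff_im.1 him)
  trans i j x hx := by
    have h1 := L.trans_comp i j (L.core.indexAt x) x ⟨hx, L.core.mem_baseSet_at x⟩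
    rw [HermitianMetric.normSq, HermitianMetric.normSq, localTriv_symm_one L i hx.1,
      localTriv_symm_one L j hx.2, ← h1, mul_comm]
    exact (H.inner x).re_inner_smul_smul (L.trans i j x) _

/-- The Hermitian metric with given squared lengths of the frames. -/
def IsMetricWeight.metric {L : HolLineBundle n X} {h : L.ι → X → ℝ} (hh : L.IsMetricWeight h) :
    L.HermitianMetric :=
  have key : ∀ i, ∀ x ∈ L.dom i,
      ((starRingEnd ℂ) (L.trans i (L.core.indexAt x) x) * L.trans i (L.core.indexAt x) x *
        (h (L.core.indexAt x) x : ℂ)).re = h i x := fun i x hx => by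
    rw [hh.trans i (L.core.indexAt x) x ⟨hx, L.core.mem_baseSet_at x⟩,
      ← Complex.normSq_eq_conj_mul_self, ← Complex.ofReal_mul, Complex.ofReal_re,
      Complex.normSq_eq_norm_sq]
  { inner := fun x =>
      { inner := fun v w : ℂ => (starRingEnd ℂ) v * w * (h (L.core.indexAt x) x : ℂ)
        conj_inner_symm := fun (v w : ℂ) => by
          simp only [map_mul, Complex.conj_conj, Complex.conj_ofReal]
          ring
        re_inner_nonneg := fun (v : ℂ) => by
          change 0 ≤ ((starRingEnd ℂ) v * v * (h (L.core.indexAt x) x : ℂ)).re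
          rw [← Complex.normSq_eq_conj_mul_self, ← Complex.ofReal_mul, Complex.ofReal_re]
          exact mul_nonneg (Complex.normSq_nonneg v)
            (hh.pos _ x (L.core.mem_baseSet_at x)).le
        add_left := fun (u v w : ℂ) => by
          change (starRingEnd ℂ) (u + v) * w * (h (L.core.indexAt x) x : ℂ) = _
          rw [map_add]
          ring
        smul_left := fun (v w r : ℂ) => by
          change (starRingEnd ℂ) (r * v) * w * (h (L.core.indexAt x) x : ℂ) = _
          rw [map_mul]
          ring
        definite := fun (v : ℂ) hv => by
          change (starRingEnd ℂ) v * v * (h (L.core.indexAt x) x : ℂ) = 0 at hv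
          have h0 := (hh.pos _ x (L.core.mem_baseSet_at x)).ne'
          have h1 : v = 0 := by simpa [h0] using hv
          exact h1 }
    smooth := fun i => (hh.smooth i).congr fun x hx => by
      rw [localTriv_symm_one L i hx]
      exact key i x hx }

lemma IsMetricWeight.normSq_metric {L : HolLineBundle n X} {h : L.ι → X → ℝ}
    (hh : L.IsMetricWeight h) (i : L.ι) {x : X} (hx : x ∈ L.dom i) :
    hh.metric.normSq i x = h i x := by
  rw [HermitianMetric.normSq, localTriv_symm_one L i hx]
  change ((starRingEnd ℂ) (L.trans i (L.core.indexAt x) x) * L.trans i (L.core.indexAt x) x *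
        (h (L.core.indexAt x) x : ℂ)).re = h i x
  rw [hh.trans i (L.core.indexAt x) x ⟨hx, L.core.mem_baseSet_at x⟩,
    ← Complex.normSq_eq_conj_mul_self, ← Complex.ofReal_mul, Complex.ofReal_re,
    Complex.normSq_eq_norm_sq]

lemma IsMetricWeight.contMDiffAt {L : HolLineBundle n X} {h : L.ι → X → ℝ}
    (hh : L.IsMetricWeight h) {i : L.ι} {x : X} (hx : x ∈ L.dom i) :
    ContMDiffAt 𝓘(ℝ, Fin n → ℂ) 𝓘(ℝ, ℝ) ∞ (h i) x :=
  (hh.smooth i).contMDiffAt ((L.isOpen_dom i).mem_nhds hx)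

/-- Positivity in terms of the squared lengths of frames: their logarithms are strictly
plurisuperharmonic. -/
lemma isPositive_iff (L : HolLineBundle n X) : L.IsPositive ↔
    ∃ h : L.ι → X → ℝ, L.IsMetricWeight h ∧ ∀ i, ∀ x ∈ L.dom i, ∀ u, u ≠ 0 →
      0 < levi (fun z => -Real.log (h i ((chartAt (Fin n → ℂ) x).symm z)))
        (chartAt (Fin n → ℂ) x x) u := by
  have key : ∀ (H : L.HermitianMetric) (i : L.ι), ∀ x ∈ L.dom i,
      (IsPositiveForm fun u v => Complex.I / (2 * Real.pi) * H.curvature i x u v) ↔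
        ∀ u, u ≠ 0 → 0 < levi (fun z => -Real.log (H.normSq i ((chartAt (Fin n → ℂ) x).symm z)))
          (chartAt (Fin n → ℂ) x x) u := by
    intro H i x hx
    refine isPositiveForm_curvatureForm_iff (H.isMetricWeight.contMDiffAt hx).contDiffAt_chart ?_
    rw [(chartAt _ x).left_inv (mem_chart_source _ x)]
    exact H.isMetricWeight.pos i x hx
  constructor
  · rintro ⟨H, hH⟩
    exact ⟨H.normSq, H.isMetricWeight, fun i x hx => (key H i x hx).1 (hH i x hx)⟩
  · rintro ⟨h, hh, hpos⟩
    refine ⟨hh.metric, fun i x hx => (key hh.metric i x hx).2 fun u hu => ?_⟩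
    -- The metric built from h has weight h only over `L.dom i`, so the two functions are compared
    -- near x.
    refine (hpos i x hx u hu).trans_eq (levi_congr ?_ u)
    have hc : ∀ᶠ z in 𝓝 (chartAt (Fin n → ℂ) x x), (chartAt (Fin n → ℂ) x).symm z ∈ L.dom i := by
      refine ((chartAt _ x).continuousAt_symm (mem_chart_target _ x)).eventually ?_
      rw [(chartAt _ x).left_inv (mem_chart_source _ x)]
      exact (L.isOpen_dom i).mem_nhds hx
    filter_upwards [hc] with z hz
    rw [hh.normSq_metric i hz]

/-- Line bundles on σ-compact manifolds have Hermitian metrics. -/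
lemma exists_isMetricWeight [T2Space X] [SigmaCompactSpace X] [IsManifold 𝓘(ℂ, Fin n → ℂ) ω X]
    (L : HolLineBundle n X) : ∃ h : L.ι → X → ℝ, L.IsMetricWeight h := by
  have := isManifold_real (Fin n → ℂ) X
  obtain ⟨ρ, hρ⟩ := SmoothPartitionOfUnity.exists_isSubordinate 𝓘(ℝ, Fin n → ℂ)
    (isClosed_univ (X := X)) L.dom L.isOpen_dom
    fun x _ => mem_iUnion.2 ⟨L.core.indexAt x, L.core.mem_baseSet_at x⟩
  -- An average of the flat metrics in which the a-th frame has length one. The values of the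
  -- transition functions outside `L.dom a` are harmless because ρ a vanishes there.
  refine ⟨fun i x => ∑ᶠ a, ρ a x • ‖L.trans i a x‖ ^ 2, ?_, ?_, ?_⟩
  · intro i x hx
    obtain ⟨a, ha⟩ := ρ.exists_pos_of_mem (mem_univ x)
    refine finsum_pos (fun b => smul_nonneg (ρ.nonneg b x) (by positivity)) ⟨a, ?_⟩ ?_
    · have hxa : x ∈ L.dom a := hρ a (subset_tsupport _ (Function.mem_support.2 ha.ne'))
      exact smul_pos ha (by have := L.trans_ne_zero i a ⟨hx, hxa⟩; positivity)
    · refine (ρ.locallyFinite.point_finite x).subset fun b hb => ?_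
      rw [Function.mem_support] at hb
      exact left_ne_zero_of_smul hb
  · intro i x hx
    refine ContMDiffAt.contMDiffWithinAt ?_
    have h := ρ.contMDiffAt_finsum (n := (⊤ : ℕ∞)) (x₀ := x) (g := fun a x => ‖L.trans i a x‖ ^ 2)
    refine h fun a ha => ?_
    have h1 : ContMDiffAt 𝓘(ℝ, Fin n → ℂ) 𝓘(ℝ, ℂ) ∞ (L.trans i a) x :=
      (L.contMDiffOn_trans i a).real_of_complex.contMDiffAt
        (((L.isOpen_dom i).inter (L.isOpen_dom a)).mem_nhds ⟨hx, hρ a ha⟩)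
    exact (contDiff_norm_sq ℝ (E := ℂ) (n := ∞)).contMDiff.contMDiffAt.comp x h1
  · intro i j x hx
    rw [mul_finsum]
    refine finsum_congr fun a => ?_
    by_cases ha : ρ a x = 0
    · simp [ha]
    · have hxa : x ∈ L.dom a := hρ a (subset_tsupport _ (Function.mem_support.2 ha))
      rw [← L.trans_comp i j a x ⟨hx, hxa⟩, norm_mul, smul_eq_mul, smul_eq_mul]
      ring

end HolLineBundle

namespace HolLineBundle

variable {n m : ℕ} {X : Type*} [TopologicalSpace X] [ChartedSpace (Fin n → ℂ) X]
  {Y : Type*} [TopologicalSpace Y] [ChartedSpace (Fin m → ℂ) Y]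

lemma IsMetricWeight.tpow {L : HolLineBundle n X} {h : L.ι → X → ℝ} (hh : L.IsMetricWeight h)
    (k : ℕ) : (L.tpow k).IsMetricWeight fun i x => h i x ^ k where
  pos i x hx := pow_pos (hh.pos i x hx) k
  smooth i := (hh.smooth i).pow k
  trans i j x hx := by
    have h1 : (L.tpow k).trans i j x = L.trans i j x ^ k := trans_ofCocycle ..
    rw [h1, hh.trans i j x hx, mul_pow, norm_pow, pow_right_comm]

lemma IsMetricWeight.tensor {L K : HolLineBundle n X} {h : L.ι → X → ℝ} {g : K.ι → X → ℝ}
    (hh : L.IsMetricWeight h) (hg : K.IsMetricWeight g) :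
    (L.tensor K).IsMetricWeight fun i x => h i.1 x * g i.2 x where
  pos i x hx := mul_pos (hh.pos i.1 x hx.1) (hg.pos i.2 x hx.2)
  smooth i := ((hh.smooth i.1).mono inter_subset_left).mul ((hg.smooth i.2).mono inter_subset_right)
  trans i j x hx := by
    have h1 : (L.tensor K).trans i j x = L.trans i.1 j.1 x * K.trans i.2 j.2 x :=
      trans_ofCocycle ..
    rw [h1, hh.trans i.1 j.1 x ⟨hx.1.1, hx.2.1⟩, hg.trans i.2 j.2 x ⟨hx.1.2, hx.2.2⟩, norm_mul]
    ring

lemma IsMetricWeight.pullback {L : HolLineBundle n X} {h : L.ι → X → ℝ} (hh : L.IsMetricWeight h)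
    {f : Y → X} (hf : ContMDiff 𝓘(ℂ, Fin m → ℂ) 𝓘(ℂ, Fin n → ℂ) ω f) :
    (L.pullback f hf).IsMetricWeight fun i y => h i (f y) where
  pos i y hy := hh.pos i (f y) hy
  smooth i := (hh.smooth i).comp hf.real_of_complex.contMDiffOn fun _ hy => hy
  trans i j y hy := by
    have h1 : (L.pullback f hf).trans i j y = L.trans i j (f y) := trans_ofCocycle ..
    rw [h1, hh.trans i j (f y) hy]

end HolLineBundle

/-! ### Squared distance from a centre -/

section Distance

variable {n : ℕ} {M : Type*} [TopologicalSpace M] [T2Space M] [ChartedSpace (Fin n → ℂ) M]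
  [IsManifold 𝓘(ℂ, Fin n → ℂ) ω M]

variable (n) in
/-- A smooth function which is the squared distance from `p` in the coordinates at `p`, near `p`,
and positive elsewhere. -/
structure IsSquaredDistance (p : M) (r : M → ℝ) : Prop where
  smooth : ContMDiff 𝓘(ℝ, Fin n → ℂ) 𝓘(ℝ, ℝ) ∞ r
  pos : ∀ x, x ≠ p → 0 < r x
  eventually_eq : ∀ᶠ x in 𝓝 p, r x = euclSq (Blowup.centered n p x)

-- A bump function ρ interpolates between |z|² near p and the constant 1. The convex combination can
-- vanish only where |z|² does inside the chart, that is, at p.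
variable (n) in
lemma exists_isSquaredDistance (p : M) : ∃ r : M → ℝ, IsSquaredDistance n p r := by
  have := isManifold_real (Fin n → ℂ) M
  obtain ⟨ρ⟩ : Nonempty (SmoothBumpFunction 𝓘(ℝ, Fin n → ℂ) p) := inferInstance
  have hs : ContMDiffOn 𝓘(ℝ, Fin n → ℂ) 𝓘(ℝ, ℝ) ∞ (fun x => euclSq (Blowup.centered n p x) - 1)
      (chartAt (Fin n → ℂ) p).source := by
    have h1 : ContMDiffOn 𝓘(ℝ, Fin n → ℂ) 𝓘(ℝ, Fin n → ℂ) ∞ (chartAt (Fin n → ℂ) p)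
        (chartAt (Fin n → ℂ) p).source := contMDiffOn_chart
    have h2 : ContDiff ℝ ∞ fun z : Fin n → ℂ => euclSq (z - chartAt (Fin n → ℂ) p p) - 1 :=
      (contDiff_euclSq.comp (contDiff_id.sub contDiff_const)).sub contDiff_const
    exact h2.contMDiff.comp_contMDiffOn h1
  refine ⟨fun x => 1 + ρ x • (euclSq (Blowup.centered n p x) - 1),
    contMDiff_const.add (ρ.contMDiff_smul hs), fun x hx => ?_, ?_⟩
  · have h1 : 0 ≤ ρ x := ρ.nonneg
    have h2 : ρ x ≤ 1 := ρ.le_one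
    rcases h1.eq_or_lt with h0 | h0
    · simp [← h0]
    · have hsrc : x ∈ (chartAt (Fin n → ℂ) p).source :=
        ρ.support_subset_source (Function.mem_support.2 h0.ne')
      have hc : Blowup.centered n p x ≠ 0 := fun hc => hx
        ((chartAt (Fin n → ℂ) p).injOn hsrc (mem_chart_source _ p) (sub_eq_zero.1 hc))
      have := euclSq_pos hc
      have := mul_pos h0 this
      rw [smul_eq_mul]
      nlinarith
  · filter_upwards [ρ.eventuallyEq_one] with x hx
    rw [hx, Pi.one_apply, one_smul]
    ring

end Distance

lemma ContMDiffAt.norm_sq_complex {E : Type*} [NormedAddCommGroup E] [NormedSpace ℝ E] {X : Type*}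
    [TopologicalSpace X] [ChartedSpace E X] {f : X → ℂ} {x : X}
    (hf : ContMDiffAt 𝓘(ℝ, E) 𝓘(ℝ, ℂ) ∞ f x) :
    ContMDiffAt 𝓘(ℝ, E) 𝓘(ℝ, ℝ) ∞ (fun y => ‖f y‖ ^ 2) x :=
  (contDiff_norm_sq ℝ (E := ℂ) (n := ∞)).contMDiff.contMDiffAt.comp x hf

/-! ### The metric on the bundle of the exceptional divisors -/

namespace Blowup

variable {n : ℕ} {M : Type*} {S : Finset M} [TopologicalSpace M] [ChartedSpace (Fin n → ℂ) M]

open Classical in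
/-- The squared length of the frame of `[E_p]` over `coverSet e`, in the metric for which the
squared length of the section `1` is `r` off the exceptional divisor `E_p`. -/
def divWeight (r : M → ℝ) (e : Option ({x : M // x ∈ S} × Fin n)) (p : {x : M // x ∈ S})
    (b : Blowup n S) : ℝ :=
  if equation e p b = 0 then euclSq (dir p.1 b) / ‖homCoord e b‖ ^ 2
  else r b.proj / ‖equation e p b‖ ^ 2

variable {r : M → ℝ} {e e' : Option ({x : M // x ∈ S} × Fin n)} {p : {x : M // x ∈ S}}

lemma divWeight_pos (hr : ∀ x, x ≠ p.1 → 0 < r x) {b : Blowup n S} (hb : b ∈ coverSet e) :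
    0 < divWeight r e p b := by
  rw [divWeight]
  split_ifs with h
  · have h1 := homCoord_ne_zero e b hb
    have h2 : dir p.1 b ≠ 0 := by
      have h3 := (equation_eq_zero_iff e p b hb).1 h
      rcases b with ⟨x, hx⟩ | ⟨q, hq, l⟩
      · exact absurd p.2 (by rw [exceptional, mem_preimage, proj_off] at h3; rwa [← h3])
      · exact l.rep_nonzero
    have := euclSq_pos h2
    positivity
  · have h1 := hr b.proj fun h3 => h ((equation_eq_zero_iff e p b hb).2 h3)
    positivity

/-- The frame over `coverSet e` is the canonical section divided by `equation e p`, whence the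
reversed indices in the ratio. Over E_p, where both equations vanish, homogeneous coordinates take
their place, as in `ratio`. -/
lemma divWeight_trans {b : Blowup n S} (hb : b ∈ coverSet e ∩ coverSet e') :
    divWeight r e p b = ‖ratio e' e p b‖ ^ 2 * divWeight r e' p b := by
  have h1 := homCoord_ne_zero e b hb.1
  have h2 := homCoord_ne_zero e' b hb.2
  have h3 := (equation_eq_zero_iff e p b hb.1).trans (equation_eq_zero_iff e' p b hb.2).symm
  by_cases h : equation e p b = 0
  · have h' := h3.1 h
    simp only [divWeight, ratio, h, h', if_true, norm_div]
    field_simp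
  · have h' : ¬ equation e' p b = 0 := fun h4 => h (h3.2 h4)
    simp only [divWeight, ratio, h, h', if_false, norm_div]
    field_simp

/-- Near the exceptional divisor, the metric is the pullback of the metric of the tautological
bundle on projective space. -/
lemma divWeight_eq_euclSq {j : Fin n} {b : Blowup n S} (hb : b ∈ coverSet (some (p, j)))
    (hr : r b.proj = euclSq (centered n p.1 b.proj)) :
    divWeight r (some (p, j)) p b =
      euclSq (Function.update (excChart n S p.1 p.2 j b) j 1) := by
  have h2 : b.dir p.1 j ≠ 0 := hb.2.1
  have h3 : Function.update (excChart n S p.1 p.2 j b) j 1 = (b.dir p.1 j)⁻¹ • b.dir p.1 :=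
    update_dirCoord j _ _ h2
  rw [h3, euclSq_smul, divWeight]
  -- In both cases the weight is |d|²/|d_j|² for homogeneous coordinates d of the line: d = z off
  -- E_p, and a representative of l on E_p.
  rcases b with ⟨x, hx⟩ | ⟨q, hq, l⟩
  · simp only [proj_off, dir_off] at hr h2
    simp only [equation, if_true, scale_off, dir_off, one_mul, h2, if_false, proj_off, hr,
      norm_inv, inv_pow, div_eq_inv_mul]
  · simp only [equation, if_true, scale_exc, dir_exc, zero_mul, homCoord, norm_inv, inv_pow,
      div_eq_inv_mul]

variable [T2Space M] [IsManifold 𝓘(ℂ, Fin n → ℂ) ω M]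

lemma contMDiffAt_equation {b : Blowup n S} (hb : b ∈ coverSet e) :
    ContMDiffAt 𝓘(ℂ, Fin n → ℂ) 𝓘(ℂ, ℂ) ω (equation e p : Blowup n S → ℂ) b :=
  (contMDiffOn_equation e p).contMDiffAt ((isOpen_coverSet e).mem_nhds hb)

lemma contMDiff_proj_real : ContMDiff 𝓘(ℝ, Fin n → ℂ) 𝓘(ℝ, Fin n → ℂ) ∞
    (proj : Blowup n S → M) := (contMDiff_proj n S).real_of_complex

lemma eventually_equation_ne_zero {b : Blowup n S} (hb : b ∈ coverSet e) (hp : b.proj ≠ p.1) :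
    ∀ᶠ b' in 𝓝 b, equation e p b' ≠ 0 :=
  (contMDiffAt_equation hb).continuousAt.eventually_ne
    fun h => hp ((equation_eq_zero_iff e p b hb).1 h)

-- The chart domains over a centre q contain no exceptional points over the other centres.
omit [T2Space M] [IsManifold 𝓘(ℂ, Fin n → ℂ) ω M] in
lemma eq_some_of_mem_coverSet {b : Blowup n S} (hb : b ∈ coverSet e) (hp : b.proj = p.1) :
    ∃ j, e = some (p, j) := by
  rcases e with _ | ⟨q, j⟩
  · exact absurd p.2 (by rw [← hp]; exact hb)
  · have h : b.proj = q.1 := hb.2.2 (by rw [hp]; exact p.2)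
    exact ⟨j, by rw [Subtype.ext (h.symm.trans hp)]⟩

lemma eventually_divWeight_eq_euclSq {j : Fin n} (hr : IsSquaredDistance n p.1 r)
    {b : Blowup n S} (hb : b ∈ coverSet (some (p, j))) (hp : b.proj = p.1) :
    ∀ᶠ b' in 𝓝 b, divWeight r (some (p, j)) p b' =
      euclSq (Function.update (excChart n S p.1 p.2 j b') j 1) := by
  have h1 : ∀ᶠ b' in 𝓝 b, r b'.proj = euclSq (centered n p.1 b'.proj) := by
    have := (contMDiff_proj n S).continuous.continuousAt (x := b)
    rw [ContinuousAt, hp] at this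
    exact this.eventually hr.eventually_eq
  filter_upwards [h1, (isOpen_coverSet _).mem_nhds hb] with b' h2 h3
  exact divWeight_eq_euclSq h3 h2

/-- Near E_p both branches of the definition agree with one smooth expression in the affine
coordinates; off E_p the weight is a quotient with nonzero denominator. -/
lemma contMDiffAt_divWeight (hr : IsSquaredDistance n p.1 r) {b : Blowup n S}
    (hb : b ∈ coverSet e) :
    ContMDiffAt 𝓘(ℝ, Fin n → ℂ) 𝓘(ℝ, ℝ) ∞ (divWeight r e p : Blowup n S → ℝ) b := by
  by_cases hp : b.proj = p.1
  · obtain ⟨j, rfl⟩ := eq_some_of_mem_coverSet hb hp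
    have h1 : ContMDiffAt 𝓘(ℝ, Fin n → ℂ) 𝓘(ℝ, Fin n → ℂ) ∞
        (excChart n S p.1 p.2 j) b :=
      (contMDiffOn_chart (excChart_mem p.1 p.2 j)).real_of_complex.contMDiffAt
        ((isOpen_coverSet (some (p, j))).mem_nhds hb)
    have h2 : ContDiff ℝ ∞ fun w : Fin n → ℂ => euclSq (Function.update w j 1) :=
      contDiff_euclSq.comp (((contDiff_update j).restrict_scalars ℝ).of_le le_top)
    exact (h2.contMDiff.contMDiffAt.comp b h1).congr_of_eventuallyEq
      (eventually_divWeight_eq_euclSq hr hb hp)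
  · have h0 := eventually_equation_ne_zero hb hp
    have h1 : ContMDiffAt 𝓘(ℝ, Fin n → ℂ) 𝓘(ℝ, ℝ) ∞ (fun b => ‖equation e p b‖ ^ 2) b :=
      ((contMDiffOn_equation e p).real_of_complex.contMDiffAt
        ((isOpen_coverSet e).mem_nhds hb)).norm_sq_complex
    have h2 : ContMDiffAt 𝓘(ℝ, Fin n → ℂ) 𝓘(ℝ, ℝ) ∞ (fun b : Blowup n S => r b.proj) b :=
      (hr.smooth.comp contMDiff_proj_real).contMDiffAt
    refine (h2.div₀ h1 (pow_ne_zero 2 (norm_ne_zero_iff.2 h0.self_of_nhds))).congr_of_eventuallyEq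
      ?_
    filter_upwards [h0] with b' hb'
    simp [divWeight, hb']

/-- The metric of the line bundle of the divisor `-∑ m_p E_p`. -/
lemma isMetricWeight_lineBundle {r : {x : M // x ∈ S} → M → ℝ}
    (hr : ∀ p, IsSquaredDistance n p.1 (r p)) (m : {x : M // x ∈ S} → ℕ) :
    ((exceptionalEquations n S).lineBundle fun p => -(m p : ℤ)).IsMetricWeight
      fun e b => (∏ p, divWeight (r p) e p b ^ m p)⁻¹ where
  pos e b hb := inv_pos.2 (Finset.prod_pos fun p _ => pow_pos (divWeight_pos (hr p).pos hb) _)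
  smooth e b hb := ContMDiffAt.contMDiffWithinAt <| by
    refine ContMDiffAt.inv₀ (contMDiffAt_finsetProd fun p _ =>
      (contMDiffAt_divWeight (hr p) hb).pow _) (Finset.prod_pos fun p _ =>
        pow_pos (divWeight_pos (hr p).pos hb) _).ne'
  trans e e' b hb := by
    have h1 : ((exceptionalEquations n S).lineBundle fun p => -(m p : ℤ)).trans e e' b =
        ∏ p, ratio e' e p b ^ (-(m p : ℤ)) := HolLineBundle.trans_ofCocycle ..
    rw [h1, norm_prod, ← Finset.prod_pow, ← Finset.prod_inv_distrib, ← Finset.prod_inv_distrib,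
      ← Finset.prod_mul_distrib]
    refine Finset.prod_congr rfl fun p _ => ?_
    rw [divWeight_trans hb, mul_pow, mul_inv, zpow_neg, zpow_natCast, norm_inv, norm_pow, inv_pow,
      pow_right_comm]

end Blowup

/-! ### Levi forms on complex manifolds -/

lemma continuousOn_levi {E : Type*} [NormedAddCommGroup E] [NormedSpace ℂ E] [NormedSpace ℝ E]
    {φ : E → ℝ} {O : Set E} (hφ : ∀ z ∈ O, ContDiffAt ℝ 2 φ z) :
    ContinuousOn (fun q : E × E => levi φ q.1 q.2) (O ×ˢ univ) := by
  have h2 : ContinuousOn (fderiv ℝ (fderiv ℝ φ)) O := fun z hz =>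
    ((((hφ z hz).fderiv_right (m := 1) (by norm_num)).fderiv_right (m := 0)
      (by norm_num)).continuousAt).continuousWithinAt
  have h3 : ContinuousOn (fun q : E × E => fderiv ℝ (fderiv ℝ φ) q.1) (O ×ˢ univ) :=
    h2.comp continuousOn_fst fun q hq => hq.1
  have hI : Continuous fun q : E × E => Complex.I • q.2 := continuous_snd.const_smul Complex.I
  exact ((h3.clm_apply continuousOn_snd).clm_apply continuousOn_snd).add
    ((h3.clm_apply hI.continuousOn).clm_apply hI.continuousOn)

section LeviAt

variable {E : Type*} [NormedAddCommGroup E] [NormedSpace ℂ E] [NormedSpace ℝ E]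
  [IsScalarTower ℝ ℂ E] {X : Type*} [TopologicalSpace X] [ChartedSpace E X]

variable (E) in
/-- The Levi form of a function on a complex manifold, in the preferred chart at the point. -/
def leviAt (f : X → ℝ) (x : X) (u : E) : ℝ :=
  levi (fun z => f ((chartAt E x).symm z)) (chartAt E x x) u

variable {f g : X → ℝ} {x : X}

variable (E) in
omit [NormedSpace ℂ E] [NormedSpace ℝ E] [IsScalarTower ℝ ℂ E] in
lemma tendsto_chartAt_symm (x : X) :
    Filter.Tendsto (chartAt E x).symm (𝓝 (chartAt E x x)) (𝓝 x) := by
  have h := (chartAt E x).continuousAt_symm (mem_chart_target E x)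
  rwa [ContinuousAt, (chartAt E x).left_inv (mem_chart_source E x)] at h

omit [IsScalarTower ℝ ℂ E] in
lemma leviAt_congr (h : f =ᶠ[𝓝 x] g) (u : E) : leviAt E f x u = leviAt E g x u :=
  levi_congr ((tendsto_chartAt_symm E x).eventually h) u

omit [IsScalarTower ℝ ℂ E] in
lemma leviAt_add (hf : ContMDiffAt 𝓘(ℝ, E) 𝓘(ℝ, ℝ) ∞ f x)
    (hg : ContMDiffAt 𝓘(ℝ, E) 𝓘(ℝ, ℝ) ∞ g x) (u : E) :
    leviAt E (fun y => f y + g y) x u = leviAt E f x u + leviAt E g x u :=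
  levi_add hf.contDiffAt_chart hg.contDiffAt_chart u

omit [IsScalarTower ℝ ℂ E] in
lemma leviAt_const_mul (hf : ContMDiffAt 𝓘(ℝ, E) 𝓘(ℝ, ℝ) ∞ f x) (c : ℝ) (u : E) :
    leviAt E (fun y => c * f y) x u = c * leviAt E f x u :=
  levi_const_mul hf.contDiffAt_chart c u

omit [IsScalarTower ℝ ℂ E] in
lemma leviAt_neg (hf : ContMDiffAt 𝓘(ℝ, E) 𝓘(ℝ, ℝ) ∞ f x) (u : E) :
    leviAt E (fun y => -f y) x u = -leviAt E f x u :=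
  levi_neg hf.contDiffAt_chart u

omit [IsScalarTower ℝ ℂ E] in
lemma leviAt_sum {κ : Type*} (s : Finset κ) {f : κ → X → ℝ}
    (hf : ∀ c ∈ s, ContMDiffAt 𝓘(ℝ, E) 𝓘(ℝ, ℝ) ∞ (f c) x) (u : E) :
    leviAt E (fun y => ∑ c ∈ s, f c y) x u = ∑ c ∈ s, leviAt E (f c) x u :=
  levi_sum s (fun c hc => (hf c hc).contDiffAt_chart) u

omit [IsScalarTower ℝ ℂ E] in
lemma leviAt_zero_right (f : X → ℝ) (x : X) : leviAt E f x 0 = 0 := levi_zero_right _ _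

omit [NormedSpace ℂ E] [IsScalarTower ℝ ℂ E] in
lemma ContMDiffAt.real_log (hf : ContMDiffAt 𝓘(ℝ, E) 𝓘(ℝ, ℝ) ∞ f x) (h0 : f x ≠ 0) :
    ContMDiffAt 𝓘(ℝ, E) 𝓘(ℝ, ℝ) ∞ (fun y => Real.log (f y)) x :=
  (Real.contDiffAt_log.2 h0).contMDiffAt.comp x hf

/-- The Levi form of the logarithm does not change under multiplication by the squared absolute
value of a nowhere zero holomorphic function. -/
lemma leviAt_log_of_eventuallyEq_mul {c : X → ℂ}
    (hc : ContMDiffAt 𝓘(ℂ, E) 𝓘(ℂ, ℂ) ω c x) (hc0 : c x ≠ 0)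
    (hg : ContMDiffAt 𝓘(ℝ, E) 𝓘(ℝ, ℝ) ∞ g x) (hg0 : g x ≠ 0)
    (h : ∀ᶠ y in 𝓝 x, f y = ‖c y‖ ^ 2 * g y) (u : E) :
    leviAt E (fun y => Real.log (f y)) x u = leviAt E (fun y => Real.log (g y)) x u := by
  have h1 : (fun y => Real.log (f y)) =ᶠ[𝓝 x]
      fun y => Real.log (‖c y‖ ^ 2) + Real.log (g y) := by
    filter_upwards [h, hc.continuousAt.eventually_ne hc0, hg.continuousAt.eventually_ne hg0]
      with y hy h2 h3
    rw [hy, Real.log_mul (pow_ne_zero 2 (norm_ne_zero_iff.2 h2)) h3]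
  have h2 : ContMDiffAt 𝓘(ℝ, E) 𝓘(ℝ, ℂ) ∞ c x := by
    have h3 := contMDiffAt_iff.1 hc
    exact contMDiffAt_iff.2 ⟨h3.1, (h3.2.restrict_scalars ℝ).of_le le_top⟩
  have hx : (chartAt E x).symm (chartAt E x x) = x := (chartAt E x).left_inv (mem_chart_source E x)
  have h4 : ContDiffAt ℂ 2 (fun z => c ((chartAt E x).symm z)) (chartAt E x x) := by
    have h3 := (contMDiffAt_iff.1 hc).2
    simp only [modelWithCornersSelf_coe, range_id, contDiffWithinAt_univ] at h3
    exact h3.of_le le_top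
  rw [leviAt_congr h1, leviAt_add
    (h2.norm_sq_complex.real_log (pow_ne_zero 2 (norm_ne_zero_iff.2 hc0))) (hg.real_log hg0)]
  have h5 : leviAt E (fun y => Real.log (‖c y‖ ^ 2)) x u = 0 :=
    levi_log_normSq h4 (by rwa [hx]) u
  rw [h5, zero_add]

/-- Large multiples of a strictly plurisubharmonic function dominate other functions, locally
uniformly. -/
lemma exists_eventually_mul_leviAt_add_pos [FiniteDimensional ℝ E] [IsManifold 𝓘(ℂ, E) ω X]
    {N : Set X} (hN : IsOpen N) (hx : x ∈ N) (hf : ∀ y ∈ N, ContMDiffAt 𝓘(ℝ, E) 𝓘(ℝ, ℝ) ∞ f y)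
    (hg : ∀ y ∈ N, ContMDiffAt 𝓘(ℝ, E) 𝓘(ℝ, ℝ) ∞ g y)
    (hpos : ∀ u, u ≠ 0 → 0 < leviAt E f x u) :
    ∃ k₀ : ℕ, ∀ᶠ y in 𝓝 x, ∀ k : ℕ, k₀ ≤ k → ∀ u, u ≠ 0 →
      0 < k * leviAt E f y u + leviAt E g y u := by
  have := isManifold_real E X
  set O := (chartAt E x).target ∩ (chartAt E x).symm ⁻¹' N
  have hO : IsOpen O := (chartAt E x).isOpen_inter_preimage_symm hN
  have hxO : chartAt E x x ∈ O :=
    ⟨mem_chart_target E x, by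
      rwa [mem_preimage, (chartAt E x).left_inv (mem_chart_source E x)]⟩
  have key : ∀ f : X → ℝ, (∀ y ∈ N, ContMDiffAt 𝓘(ℝ, E) 𝓘(ℝ, ℝ) ∞ f y) → ∀ z ∈ O,
      ContDiffAt ℝ 2 (fun z => f ((chartAt E x).symm z)) z := by
    intro f hf z hz
    have h := (hf _ hz.2).contDiffAt_chart_of_mem_source ((chartAt E x).map_target hz.1)
    rwa [(chartAt E x).right_inv hz.1] at h
  obtain ⟨k₀, hk₀⟩ := exists_forall_mul_add_pos hO hxO (continuousOn_levi (key f hf))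
    (continuousOn_levi (key g hg)) (fun z u t => levi_smul _ z u t)
    (fun z u t => levi_smul _ z u t) hpos
  refine ⟨k₀, ?_⟩
  have h1 := ((chartAt E x).continuousAt (mem_chart_source E x)).eventually hk₀
  filter_upwards [h1, (chartAt E x).open_source.mem_nhds (mem_chart_source E x),
    hN.mem_nhds hx] with y hy hys hyN k hk u hu
  -- At y, `leviAt` uses the preferred chart at y, which need not vary continuously with y. The
  -- estimate holds in the fixed chart at x, and T carries it over.
  obtain ⟨T, hT0, hT⟩ := exists_levi_chart_eq hys
  rw [leviAt, leviAt, hT f (hf y hyN), hT g (hg y hyN)]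
  exact hy k hk (T u) fun h => hu (hT0 u h)

end LeviAt

/-- Weights of two frames differ by the squared modulus of a transition function, whose logarithm
has zero Levi form. Local estimates can therefore be made in one fixed frame. -/
lemma HolLineBundle.IsMetricWeight.leviAt_neg_log_eq {n : ℕ} {X : Type*} [TopologicalSpace X]
    [ChartedSpace (Fin n → ℂ) X] {L : HolLineBundle n X} {h : L.ι → X → ℝ}
    (hh : L.IsMetricWeight h) {i j : L.ι} {x : X} (hi : x ∈ L.dom i) (hj : x ∈ L.dom j)
    (u : Fin n → ℂ) :
    leviAt (Fin n → ℂ) (fun y => -Real.log (h i y)) x u =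
      leviAt (Fin n → ℂ) (fun y => -Real.log (h j y)) x u := by
  have hO : L.dom i ∩ L.dom j ∈ 𝓝 x := ((L.isOpen_dom i).inter (L.isOpen_dom j)).mem_nhds ⟨hi, hj⟩
  rw [leviAt_neg ((hh.contMDiffAt hi).real_log (hh.pos i x hi).ne'),
    leviAt_neg ((hh.contMDiffAt hj).real_log (hh.pos j x hj).ne'),
    leviAt_log_of_eventuallyEq_mul ((L.contMDiffOn_trans i j).contMDiffAt hO)
      (L.trans_ne_zero i j ⟨hi, hj⟩) (hh.contMDiffAt hj) (hh.pos j x hj).ne'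
      (Filter.mem_of_superset hO fun y hy => hh.trans i j y hy)]

/-! ### The uniform estimate on the base -/

section Base

variable {n : ℕ} {M : Type*} [TopologicalSpace M] [T2Space M] [ChartedSpace (Fin n → ℂ) M]
  [IsManifold 𝓘(ℂ, Fin n → ℂ) ω M]

omit [T2Space M] in
/-- The logarithm of the squared distance from `p` is plurisubharmonic near `p`. -/
lemma IsSquaredDistance.eventually_leviAt_log_nonneg {p : M} {r : M → ℝ}
    (hr : IsSquaredDistance n p r) : ∀ᶠ x in 𝓝 p, x ≠ p → ∀ u,
      0 ≤ leviAt (Fin n → ℂ) (fun y => Real.log (r y)) x u := by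
  filter_upwards [hr.eventually_eq.eventually_nhds,
    (chartAt (Fin n → ℂ) p).open_source.mem_nhds (mem_chart_source _ p)] with x hx hxs hxp u
  obtain ⟨T, -, hT⟩ := exists_levi_chart_eq (E := Fin n → ℂ) hxs
  have hd : chartAt (Fin n → ℂ) p x - chartAt (Fin n → ℂ) p p ≠ 0 := fun h => hxp
    ((chartAt (Fin n → ℂ) p).injOn hxs (mem_chart_source _ p) (sub_eq_zero.1 h))
  rw [leviAt, hT _ (hr.smooth.contMDiffAt.real_log (hr.pos x hxp).ne')]
  have h1 : (fun z => Real.log (r ((chartAt (Fin n → ℂ) p).symm z)))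
      =ᶠ[𝓝 (chartAt (Fin n → ℂ) p x)]
      (fun d => Real.log (euclSq d)) ∘ fun z => z - chartAt (Fin n → ℂ) p p := by
    have h2 := (chartAt (Fin n → ℂ) p).continuousAt_symm
      ((chartAt (Fin n → ℂ) p).map_source hxs)
    rw [ContinuousAt, (chartAt (Fin n → ℂ) p).left_inv hxs] at h2
    filter_upwards [h2.eventually hx, (chartAt (Fin n → ℂ) p).open_target.mem_nhds
      ((chartAt (Fin n → ℂ) p).map_source hxs)] with z hz hzt
    rw [hz, Blowup.centered, (chartAt (Fin n → ℂ) p).right_inv hzt]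
    rfl
  rw [levi_congr h1, levi_comp (f := fun z => z - chartAt (Fin n → ℂ) p p)
    (contDiff_euclSq.contDiffAt.log (euclSq_pos hd).ne') (contDiffAt_id.sub contDiffAt_const)]
  exact levi_log_euclSq_nonneg hd _

variable {S : Finset M} {L K : HolLineBundle n M}
  {h : L.ι → M → ℝ} {g : K.ι → M → ℝ} {r : {x : M // x ∈ S} → M → ℝ}

open Classical in
/-- The Levi form at `x` of the weight of the metric `h ^ k * g * ∏ r ^ (-m)`, where the product
extends over the centres other than `x`. -/
def baseLevi (h : L.ι → M → ℝ) (g : K.ι → M → ℝ) (r : {x : M // x ∈ S} → M → ℝ)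
    (m : {x : M // x ∈ S} → ℕ) (k : ℕ) (i : L.ι) (j : K.ι) (x : M) (u : Fin n → ℂ) : ℝ :=
  k * leviAt (Fin n → ℂ) (fun y => -Real.log (h i y)) x u +
    leviAt (Fin n → ℂ) (fun y => -Real.log (g j y)) x u +
    ∑ p : {x : M // x ∈ S} with p.1 ≠ x, (m p : ℝ) *
      leviAt (Fin n → ℂ) (fun y => Real.log (r p y)) x u

/-- Near x₀ the terms of centres other than x₀ are smooth, so together with the term of K they are
dominated by a multiple of the positive form of L. If x₀ is a centre, its own term enters at x ≠ x₀
with a singularity at x₀, but it is nonnegative there and can be discarded. -/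
lemma exists_eventually_baseLevi_pos (hh : L.IsMetricWeight h) (hg : K.IsMetricWeight g)
    (hr : ∀ p, IsSquaredDistance n p.1 (r p)) (m : {x : M // x ∈ S} → ℕ)
    (hpos : ∀ i, ∀ x ∈ L.dom i, ∀ u, u ≠ 0 →
      0 < leviAt (Fin n → ℂ) (fun y => -Real.log (h i y)) x u) (x₀ : M) :
    ∃ k₀ : ℕ, ∀ᶠ x in 𝓝 x₀, ∀ k : ℕ, k₀ ≤ k → ∀ i j, x ∈ L.dom i → x ∈ K.dom j → ∀ u, u ≠ 0 →
      0 < baseLevi h g r m k i j x u := by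
  classical
  set i₀ := L.core.indexAt x₀
  set j₀ := K.core.indexAt x₀
  have hi₀ : x₀ ∈ L.dom i₀ := L.core.mem_baseSet_at x₀
  have hj₀ : x₀ ∈ K.dom j₀ := K.core.mem_baseSet_at x₀
  -- Away from the other centres, log (r p) is smooth for every p ≠ x₀.
  set N : Set M := L.dom i₀ ∩ K.dom j₀ ∩ ((S : Set M) \ {x₀})ᶜ
  have hN : IsOpen N := ((L.isOpen_dom i₀).inter (K.isOpen_dom j₀)).inter
    (S.finite_toSet.subset sdiff_subset).isClosed.isOpen_compl
  have hx₀ : x₀ ∈ N := ⟨⟨hi₀, hj₀⟩, fun h => h.2 rfl⟩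
  have hA : ∀ y ∈ N, ContMDiffAt 𝓘(ℝ, Fin n → ℂ) 𝓘(ℝ, ℝ) ∞ (fun y => -Real.log (h i₀ y)) y :=
    fun y hy => ((hh.contMDiffAt hy.1.1).real_log (hh.pos _ y hy.1.1).ne').neg
  have hB : ∀ y ∈ N, ContMDiffAt 𝓘(ℝ, Fin n → ℂ) 𝓘(ℝ, ℝ) ∞ (fun y => -Real.log (g j₀ y)) y :=
    fun y hy => ((hg.contMDiffAt hy.1.2).real_log (hg.pos _ y hy.1.2).ne').neg
  have hne : ∀ y ∈ N, ∀ p : {x : M // x ∈ S}, p.1 ≠ x₀ → y ≠ p.1 := fun y hy p hp hyp =>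
    hy.2 ⟨by rw [hyp]; exact p.2, by rw [hyp]; exact hp⟩
  have hR : ∀ y ∈ N, ∀ p : {x : M // x ∈ S}, p.1 ≠ x₀ →
      ContMDiffAt 𝓘(ℝ, Fin n → ℂ) 𝓘(ℝ, ℝ) ∞ (fun y => Real.log (r p y)) y :=
    fun y hy p hp => (hr p).smooth.contMDiffAt.real_log ((hr p).pos y (hne y hy p hp)).ne'
  have hR' : ∀ y ∈ N, ∀ p ∈ Finset.univ.filter fun p : {x : M // x ∈ S} => p.1 ≠ x₀,
      ContMDiffAt 𝓘(ℝ, Fin n → ℂ) 𝓘(ℝ, ℝ) ∞ (fun y => (m p : ℝ) * Real.log (r p y)) y :=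
    fun y hy p hp => contMDiffAt_const.mul (hR y hy p (Finset.mem_filter.1 hp).2)
  have hR'' : ∀ y ∈ N, ContMDiffAt 𝓘(ℝ, Fin n → ℂ) 𝓘(ℝ, ℝ) ∞
      (fun y => ∑ p : {x : M // x ∈ S} with p.1 ≠ x₀, (m p : ℝ) * Real.log (r p y)) y :=
    fun y hy => contMDiffAt_finsetSum fun p hp => hR' y hy p hp
  obtain ⟨k₀, hk₀⟩ := exists_eventually_mul_leviAt_add_pos (g := fun y => -Real.log (g j₀ y) +
    ∑ p : {x : M // x ∈ S} with p.1 ≠ x₀, (m p : ℝ) * Real.log (r p y)) hN hx₀ hA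
    (fun y hy => (hB y hy).add (hR'' y hy)) (hpos i₀ x₀ hi₀)
  refine ⟨k₀, ?_⟩
  have hnear : ∀ᶠ x in 𝓝 x₀, ∀ p : {x : M // x ∈ S}, p.1 = x₀ → x ≠ x₀ → ∀ u,
      0 ≤ leviAt (Fin n → ℂ) (fun y => Real.log (r p y)) x u := by
    rw [Filter.eventually_all]
    rintro p
    by_cases hp : p.1 = x₀
    · have := (hr p).eventually_leviAt_log_nonneg
      rw [hp] at this
      exact this.mono fun x hx _ => hx
    · exact Filter.Eventually.of_forall fun x h => absurd h hp
  filter_upwards [hk₀, hnear, hN.mem_nhds hx₀] with x hx hxn hxN k hk i j hi hj u hu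
  have h1 := hx k hk u hu
  rw [leviAt_add (hB x hxN) (hR'' x hxN), leviAt_sum _ (hR' x hxN), ← add_assoc,
    ← hh.leviAt_neg_log_eq hi hxN.1.1, ← hg.leviAt_neg_log_eq hj hxN.1.2] at h1
  rw [baseLevi]
  refine h1.trans_le (add_le_add_right ?_ _)
  rw [Finset.sum_congr rfl fun p hp => leviAt_const_mul (hR x hxN p (Finset.mem_filter.1 hp).2) _ u]
  by_cases hxx : x = x₀
  · rw [hxx]
  -- The sum over p ≠ x contains the sum over p ≠ x₀; an additional index can only be x₀, with a
  -- nonnegative term.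
  · refine Finset.sum_le_sum_of_subset_of_nonneg (fun p hp => ?_) fun p _ hp => ?_
    · exact Finset.mem_filter.2 ⟨Finset.mem_univ p,
        (hne x hxN p (Finset.mem_filter.1 hp).2).symm⟩
    · have hp' : p.1 = x₀ := by simpa using hp
      exact mul_nonneg (Nat.cast_nonneg _) (hxn p hp' hxx u)

/-- Compactness of M makes the local thresholds uniform: a finite union of sets is served by the
maximum of theirs. -/
lemma exists_forall_baseLevi_pos [CompactSpace M] (hh : L.IsMetricWeight h)
    (hg : K.IsMetricWeight g) (hr : ∀ p, IsSquaredDistance n p.1 (r p))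
    (m : {x : M // x ∈ S} → ℕ)
    (hpos : ∀ i, ∀ x ∈ L.dom i, ∀ u, u ≠ 0 →
      0 < leviAt (Fin n → ℂ) (fun y => -Real.log (h i y)) x u) :
    ∃ k₀ : ℕ, ∀ k : ℕ, k₀ ≤ k → ∀ x i j, x ∈ L.dom i → x ∈ K.dom j → ∀ u, u ≠ 0 →
      0 < baseLevi h g r m k i j x u := by
  have key : ∃ k₀ : ℕ, ∀ x ∈ (univ : Set M), ∀ k : ℕ, k₀ ≤ k → ∀ i j, x ∈ L.dom i → x ∈ K.dom j →
      ∀ u, u ≠ 0 → 0 < baseLevi h g r m k i j x u := by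
    refine isCompact_univ.induction_on (p := fun s => ∃ k₀ : ℕ, ∀ x ∈ s, ∀ k : ℕ, k₀ ≤ k → ∀ i j,
      x ∈ L.dom i → x ∈ K.dom j → ∀ u, u ≠ 0 → 0 < baseLevi h g r m k i j x u) ?_ ?_ ?_ ?_
    · exact ⟨0, fun x hx => absurd hx (notMem_empty x)⟩
    · rintro s t hst ⟨k₀, hk₀⟩
      exact ⟨k₀, fun x hx => hk₀ x (hst hx)⟩
    · rintro s t ⟨k₁, hk₁⟩ ⟨k₂, hk₂⟩
      refine ⟨max k₁ k₂, ?_⟩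
      rintro x (hx | hx) k hk
      · exact hk₁ x hx k ((le_max_left _ _).trans hk)
      · exact hk₂ x hx k ((le_max_right _ _).trans hk)
    · intro x _
      obtain ⟨k₀, hk₀⟩ := exists_eventually_baseLevi_pos hh hg hr m hpos x
      exact ⟨_, mem_nhdsWithin_of_mem_nhds hk₀, k₀, fun y hy => hy⟩
  obtain ⟨k₀, hk₀⟩ := key
  exact ⟨k₀, fun k hk x => hk₀ x (mem_univ x) k hk⟩

end Base

/-! ### Levi forms on the blowup -/

namespace Blowup

variable {n : ℕ}

lemma hasFDerivAt_update (j : Fin n) (w : Fin n → ℂ) : ∃ U : (Fin n → ℂ) →L[ℝ] (Fin n → ℂ),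
    HasFDerivAt (fun w : Fin n → ℂ => Function.update w j (1 : ℂ)) U w ∧
      ∀ u, U u = Function.update u j 0 := by
  refine ⟨ContinuousLinearMap.pi fun i => if i = j then 0 else ContinuousLinearMap.proj i, ?_, ?_⟩
  · rw [hasFDerivAt_pi]
    intro i
    by_cases h : i = j
    · subst h
      simpa using hasFDerivAt_const (1 : ℂ) w
    · simp only [h, if_false, Function.update_of_ne, ne_eq, not_false_eq_true]
      exact (ContinuousLinearMap.proj (R := ℝ) (φ := fun _ : Fin n => ℂ) i).hasFDerivAt
  · intro u
    ext i
    by_cases h : i = j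
    · subst h; simp
    · simp [h]

lemma fderiv_update_apply (j : Fin n) (w u : Fin n → ℂ) :
    fderiv ℝ (fun w : Fin n → ℂ => Function.update w j (1 : ℂ)) w u = Function.update u j 0 := by
  obtain ⟨U, hU, h⟩ := hasFDerivAt_update j w
  rw [hU.fderiv, h]

/-- This is dπ at a point of the exceptional divisor. In the product of w_j with the direction
vector, only the derivative of w_j survives where w_j = 0. The kernel u_j = 0 is the tangent space
of the divisor, and the image is the line which the point represents. -/
lemma fderiv_add_monoidal_apply (j : Fin n) (c w u : Fin n → ℂ) (hw : w j = 0) :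
    fderiv ℝ (fun w => c + monoidal j w) w u = u j • Function.update w j 1 := by
  obtain ⟨U, hU, h⟩ := hasFDerivAt_update j w
  have h1 : HasFDerivAt (fun w : Fin n → ℂ => w j)
      (ContinuousLinearMap.proj (R := ℝ) (φ := fun _ : Fin n => ℂ) j) w :=
    (ContinuousLinearMap.proj (R := ℝ) (φ := fun _ : Fin n => ℂ) j).hasFDerivAt
  have h2 : HasFDerivAt (fun w => c + monoidal j w) _ w := (h1.fun_smul hU).const_add c
  rw [h2.fderiv]
  simp [hw]

variable {M : Type*} {S : Finset M} [TopologicalSpace M] [ChartedSpace (Fin n → ℂ) M] [T2Space M]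
  [IsManifold 𝓘(ℂ, Fin n → ℂ) ω M]

/-- Off the centres the Levi forms on the blowup and on the base agree. -/
lemma leviAt_comp_proj_off (f : M → ℝ) (x : M) (hx : x ∉ S) (u : Fin n → ℂ) :
    leviAt (Fin n → ℂ) (fun b : Blowup n S => f b.proj) (off x hx) u =
      leviAt (Fin n → ℂ) f x u := by
  have h1 : (chartAt (Fin n → ℂ) (off x hx : Blowup n S)) (off x hx) = chartAt (Fin n → ℂ) x x :=
    rfl
  rw [leviAt, leviAt, h1]
  refine levi_congr ?_ u
  have h2 := (chartAt (Fin n → ℂ) (off x hx : Blowup n S)).open_target.mem_nhds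
    (mem_chart_target _ _)
  rw [h1] at h2
  filter_upwards [h2] with z hz
  have h3 : (chartAt (Fin n → ℂ) (off x hx : Blowup n S)).symm z =
      off ((chartAt (Fin n → ℂ) x).symm z) hz.2 := regChart_symm hz
  rw [h3, proj_off]

/-- The index of the preferred chart at a point of the exceptional divisor. -/
def coordIndex (l : ℙ ℂ (Fin n → ℂ)) : Fin n := (exists_coord l).choose

section Exceptional

variable {q : M} (hq : q ∈ S) (l : ℙ ℂ (Fin n → ℂ))

omit [T2Space M] [IsManifold 𝓘(ℂ, Fin n → ℂ) ω M] in
lemma exc_mem_coverSet :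
    (exc q hq l : Blowup n S) ∈ coverSet (some ((⟨q, hq⟩ : {x : M // x ∈ S}), coordIndex l)) :=
  ⟨mem_chart_source _ q, (exists_coord l).choose_spec, fun _ => rfl⟩

lemma chartAt_exc_apply (b : Blowup n S) : chartAt (Fin n → ℂ) (exc q hq l : Blowup n S) b =
    excChart n S q hq (coordIndex l) b := rfl

lemma chartAt_exc_coordIndex :
    chartAt (Fin n → ℂ) (exc q hq l : Blowup n S) (exc q hq l) (coordIndex l) = 0 := by
  rw [chartAt_exc_apply]
  change dirCoord _ _ _ _ = _
  rw [dirCoord_self, scale_exc, zero_mul]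

/-- Over a centre, the Levi form of a pulled back function is a degenerate pullback of the Levi form
on the base. -/
lemma leviAt_comp_proj_exc {f : M → ℝ} (hf : ContMDiffAt 𝓘(ℝ, Fin n → ℂ) 𝓘(ℝ, ℝ) ∞ f q)
    (u : Fin n → ℂ) :
    leviAt (Fin n → ℂ) (fun b : Blowup n S => f b.proj) (exc q hq l) u =
      leviAt (Fin n → ℂ) f q (u (coordIndex l) • Function.update
        (chartAt (Fin n → ℂ) (exc q hq l : Blowup n S) (exc q hq l)) (coordIndex l) 1) := by
  set b₀ : Blowup n S := exc q hq l
  set w₀ := chartAt (Fin n → ℂ) b₀ b₀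
  set j := coordIndex l
  set c : (Fin n → ℂ) → Fin n → ℂ := fun w => chartAt (Fin n → ℂ) q q + monoidal j w with hc
  have hw₀ : w₀ j = 0 := chartAt_exc_coordIndex hq l
  have hcw : c w₀ = chartAt (Fin n → ℂ) q q := by
    rw [hc]
    simp [(monoidal_eq_zero j w₀).2 hw₀]
  have h1 : (fun w => f ((chartAt (Fin n → ℂ) b₀).symm w).proj) =ᶠ[𝓝 w₀]
      (fun z => f ((chartAt (Fin n → ℂ) q).symm z)) ∘ c := by
    filter_upwards [(chartAt (Fin n → ℂ) b₀).open_target.mem_nhds (mem_chart_target _ b₀)] with w hw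
    have h2 : ((chartAt (Fin n → ℂ) b₀).symm w).proj = blowdown n q j w := proj_excInv hw
    rw [h2]
    rfl
  have h3 : ContDiffAt ℝ 2 (fun z => f ((chartAt (Fin n → ℂ) q).symm z)) (c w₀) := by
    rw [hcw]
    exact hf.contDiffAt_chart
  rw [leviAt, levi_congr h1, levi_comp h3
    ((contDiff_const.add (contDiff_monoidal j)).contDiffAt.of_le le_top),
    fderiv_add_monoidal_apply j _ _ _ hw₀, hcw, leviAt]

variable {r : M → ℝ} {e : Option ({x : M // x ∈ S} × Fin n)}

/-- Over a centre, the Levi form of the weight of the metric of `[-E]` is that of the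
Fubini-Study metric of the projective space. -/
lemma leviAt_log_divWeight_exc (hr : IsSquaredDistance n q r)
    (he : (exc q hq l : Blowup n S) ∈ coverSet e) (u : Fin n → ℂ) :
    leviAt (Fin n → ℂ) (fun b : Blowup n S => Real.log (divWeight r e ⟨q, hq⟩ b)) (exc q hq l) u =
      levi (fun d => Real.log (euclSq d)) (Function.update
        (chartAt (Fin n → ℂ) (exc q hq l : Blowup n S) (exc q hq l)) (coordIndex l) 1)
        (Function.update u (coordIndex l) 0) := by
  set b₀ : Blowup n S := exc q hq l
  set w₀ := chartAt (Fin n → ℂ) b₀ b₀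
  set j := coordIndex l
  set p : {x : M // x ∈ S} := ⟨q, hq⟩
  set e₀ : Option ({x : M // x ∈ S} × Fin n) := some (p, j)
  have hb₀ : b₀ ∈ coverSet e₀ := exc_mem_coverSet hq l
  have hmem : coverSet e₀ ∩ coverSet e ∈ 𝓝 b₀ :=
    ((isOpen_coverSet e₀).inter (isOpen_coverSet e)).mem_nhds ⟨hb₀, he⟩
  have hratio : ratio e₀ e p b₀ ≠ 0 :=
    (exceptionalEquations n S).unit_ne_zero e₀ e p b₀ ⟨hb₀, he⟩
  -- A change of frame passes from e to the index e₀ of the preferred chart, where the weight is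
  -- explicit near the point.
  rw [leviAt_log_of_eventuallyEq_mul (g := divWeight r e₀ p) (c := ratio e₀ e p)
    ((contMDiffOn_ratio e₀ e p).contMDiffAt hmem) hratio (contMDiffAt_divWeight hr hb₀)
    (divWeight_pos hr.pos hb₀).ne' (Filter.mem_of_superset hmem fun b hb =>
      divWeight_trans ⟨hb.2, hb.1⟩)]
  have h1 : (fun w => Real.log (divWeight r e₀ p ((chartAt (Fin n → ℂ) b₀).symm w))) =ᶠ[𝓝 w₀]
      (fun d => Real.log (euclSq d)) ∘ fun w => Function.update w j 1 := by
    filter_upwards [(tendsto_chartAt_symm (Fin n → ℂ) b₀).eventually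
      (eventually_divWeight_eq_euclSq hr hb₀ rfl),
      (chartAt (Fin n → ℂ) b₀).open_target.mem_nhds (mem_chart_target _ b₀)] with w hw hwt
    have h2 : excChart n S q hq j ((chartAt (Fin n → ℂ) b₀).symm w) = w :=
      (chartAt (Fin n → ℂ) b₀).right_inv hwt
    rw [hw, h2]
    rfl
  rw [leviAt, levi_congr h1, levi_comp (f := fun w => Function.update w j 1)
    (contDiff_euclSq.contDiffAt.log (euclSq_pos (update_ne j w₀)).ne')
    ((contDiff_update j).contDiffAt.of_le le_top), fderiv_update_apply]

end Exceptional

/-- Off the exceptional divisor `E_p`, the Levi form of the weight of the metric of `[-E_p]` is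
that of the weight of the section `1`. -/
lemma leviAt_log_divWeight_of_ne {p : {x : M // x ∈ S}} {r : M → ℝ}
    {e : Option ({x : M // x ∈ S} × Fin n)} (hr : IsSquaredDistance n p.1 r) {b : Blowup n S}
    (hb : b ∈ coverSet e) (hp : b.proj ≠ p.1) (u : Fin n → ℂ) :
    leviAt (Fin n → ℂ) (fun b : Blowup n S => Real.log (divWeight r e p b)) b u =
      leviAt (Fin n → ℂ) (fun b : Blowup n S => Real.log (r b.proj)) b u := by
  have h0 := eventually_equation_ne_zero hb hp
  -- Off E_p, r ∘ π is `divWeight` times the squared modulus of the local equation, which is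
  -- holomorphic and nonzero there.
  refine (leviAt_log_of_eventuallyEq_mul (contMDiffAt_equation (p := p) hb) h0.self_of_nhds
    (contMDiffAt_divWeight hr hb) (divWeight_pos hr.pos hb).ne' ?_ u).symm
  filter_upwards [h0] with b' hb'
  rw [divWeight, if_neg hb']
  field_simp

variable {L K : HolLineBundle n M} {h : L.ι → M → ℝ} {g : K.ι → M → ℝ}
  {r : {x : M // x ∈ S} → M → ℝ}

/-- The Levi form of the weight of the product metric on the blowup. -/
lemma leviAt_weight (hh : L.IsMetricWeight h) (hg : K.IsMetricWeight g)
    (hr : ∀ p, IsSquaredDistance n p.1 (r p)) (m : {x : M // x ∈ S} → ℕ) (k : ℕ) {i : L.ι}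
    {j : K.ι} {e : Option ({x : M // x ∈ S} × Fin n)} {b : Blowup n S} (hi : b.proj ∈ L.dom i)
    (hj : b.proj ∈ K.dom j) (he : b ∈ coverSet e) (u : Fin n → ℂ) :
    leviAt (Fin n → ℂ) (fun b : Blowup n S => -Real.log (h i b.proj ^ k * g j b.proj *
        (∏ p, divWeight (r p) e p b ^ m p)⁻¹)) b u =
      k * leviAt (Fin n → ℂ) (fun b : Blowup n S => -Real.log (h i b.proj)) b u +
        leviAt (Fin n → ℂ) (fun b : Blowup n S => -Real.log (g j b.proj)) b u +
        ∑ p, (m p : ℝ) *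
          leviAt (Fin n → ℂ) (fun b : Blowup n S => Real.log (divWeight (r p) e p b)) b u := by
  have hproj : ContMDiffAt 𝓘(ℝ, Fin n → ℂ) 𝓘(ℝ, Fin n → ℂ) ∞ (proj : Blowup n S → M) b :=
    contMDiff_proj_real.contMDiffAt
  have h1 : ContMDiffAt 𝓘(ℝ, Fin n → ℂ) 𝓘(ℝ, ℝ) ∞
      (fun b : Blowup n S => -Real.log (h i b.proj)) b :=
    (((hh.contMDiffAt hi).comp b hproj).real_log (hh.pos i _ hi).ne').neg
  have h2 : ContMDiffAt 𝓘(ℝ, Fin n → ℂ) 𝓘(ℝ, ℝ) ∞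
      (fun b : Blowup n S => -Real.log (g j b.proj)) b :=
    (((hg.contMDiffAt hj).comp b hproj).real_log (hg.pos j _ hj).ne').neg
  have h3 : ∀ p, ContMDiffAt 𝓘(ℝ, Fin n → ℂ) 𝓘(ℝ, ℝ) ∞
      (fun b : Blowup n S => Real.log (divWeight (r p) e p b)) b := fun p =>
    (contMDiffAt_divWeight (hr p) he).real_log (divWeight_pos (hr p).pos he).ne'
  have h3' : ∀ p ∈ Finset.univ, ContMDiffAt 𝓘(ℝ, Fin n → ℂ) 𝓘(ℝ, ℝ) ∞
      (fun b : Blowup n S => (m p : ℝ) * Real.log (divWeight (r p) e p b)) b := fun p _ =>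
    contMDiffAt_const.mul (h3 p)
  have h4 : (fun b : Blowup n S => -Real.log (h i b.proj ^ k * g j b.proj *
        (∏ p, divWeight (r p) e p b ^ m p)⁻¹)) =ᶠ[𝓝 b]
      fun b => (k * -Real.log (h i b.proj) + -Real.log (g j b.proj)) +
        ∑ p, (m p : ℝ) * Real.log (divWeight (r p) e p b) := by
    filter_upwards [hproj.continuousAt.eventually ((L.isOpen_dom i).mem_nhds hi),
      hproj.continuousAt.eventually ((K.isOpen_dom j).mem_nhds hj),
      (isOpen_coverSet e).mem_nhds he] with b' hi' hj' he'
    have h5 := (hh.pos i _ hi').ne'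
    have h6 := (hg.pos j _ hj').ne'
    have h7 : ∀ p ∈ Finset.univ, divWeight (r p) e p b' ^ m p ≠ 0 := fun p _ =>
      pow_ne_zero _ (divWeight_pos (hr p).pos he').ne'
    rw [Real.log_mul (mul_ne_zero (pow_ne_zero k h5) h6) (inv_ne_zero (Finset.prod_ne_zero_iff.2 h7)),
      Real.log_mul (pow_ne_zero k h5) h6, Real.log_inv, Real.log_prod h7]
    simp only [Real.log_pow]
    ring
  have h8 : ContMDiffAt 𝓘(ℝ, Fin n → ℂ) 𝓘(ℝ, ℝ) ∞
      (fun b : Blowup n S => k * -Real.log (h i b.proj)) b := contMDiffAt_const.mul h1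
  have h9 : ContMDiffAt 𝓘(ℝ, Fin n → ℂ) 𝓘(ℝ, ℝ) ∞
      (fun b : Blowup n S => k * -Real.log (h i b.proj) + -Real.log (g j b.proj)) b := h8.add h2
  rw [leviAt_congr h4, leviAt_add h9 (contMDiffAt_finsetSum h3'), leviAt_add h8 h2,
    leviAt_const_mul h1, leviAt_sum _ h3']
  simp only [fun p => leviAt_const_mul (h3 p) (m p : ℝ) u]

/-- If the weights on the base are strictly plurisubharmonic away from the centres, then so are the
weights on the blowup. -/
lemma leviAt_weight_pos (hh : L.IsMetricWeight h) (hg : K.IsMetricWeight g)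
    (hr : ∀ p, IsSquaredDistance n p.1 (r p)) {m : {x : M // x ∈ S} → ℕ} (hm : ∀ p, 0 < m p)
    {k : ℕ} {i : L.ι} {j : K.ι} {e : Option ({x : M // x ∈ S} × Fin n)} {b : Blowup n S}
    (hi : b.proj ∈ L.dom i) (hj : b.proj ∈ K.dom j) (he : b ∈ coverSet e)
    (hpos : ∀ u, u ≠ 0 → 0 < baseLevi h g r m k i j b.proj u) (u : Fin n → ℂ) (hu : u ≠ 0) :
    0 < leviAt (Fin n → ℂ) (fun b : Blowup n S => -Real.log (h i b.proj ^ k * g j b.proj *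
        (∏ p, divWeight (r p) e p b ^ m p)⁻¹)) b u := by
  classical
  rw [leviAt_weight hh hg hr m k hi hj he]
  rcases b with ⟨x, hx⟩ | ⟨q, hq, l⟩
  -- At a point which is not a centre, `baseLevi` leaves out no term and equals the form on the
  -- blowup.
  · have hne : ∀ p : {x : M // x ∈ S}, p.1 ≠ x := fun p hp => hx (hp ▸ p.2)
    refine (hpos u hu).trans_eq ?_
    rw [baseLevi, leviAt_comp_proj_off (fun y => -Real.log (h i y)),
      leviAt_comp_proj_off (fun y => -Real.log (g j y)), proj_off]
    congr 1
    refine Finset.sum_congr (Finset.filter_true_of_mem fun p _ => hne p) fun p _ => ?_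
    rw [leviAt_log_divWeight_of_ne (hr p) he (hne p).symm,
      leviAt_comp_proj_off (fun y => Real.log (r p y))]
  · set b₀ : Blowup n S := exc q hq l
    set p₀ : {x : M // x ∈ S} := ⟨q, hq⟩
    set d := Function.update (chartAt (Fin n → ℂ) b₀ b₀) (coordIndex l) 1
    set v := u (coordIndex l) • d with hv
    have hd : d ≠ 0 := update_ne _ _
    -- The other centres contribute only through the image v of u under dπ; the centre q contributes
    -- the Fubini-Study form on the part of u tangent to the divisor.
    have hsum : ∑ p, (m p : ℝ) * leviAt (Fin n → ℂ)
          (fun b : Blowup n S => Real.log (divWeight (r p) e p b)) b₀ u =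
        ∑ p : {x : M // x ∈ S} with p.1 ≠ q, (m p : ℝ) *
          leviAt (Fin n → ℂ) (fun y => Real.log (r p y)) q v +
        m p₀ * levi (fun d => Real.log (euclSq d)) d (Function.update u (coordIndex l) 0) := by
      rw [← Finset.sum_filter_add_sum_filter_not Finset.univ
        (fun p : {x : M // x ∈ S} => p.1 ≠ q)]
      congr 1
      · refine Finset.sum_congr rfl fun p hp => ?_
        have hpq : q ≠ p.1 := (Finset.mem_filter.1 hp).2.symm
        rw [leviAt_log_divWeight_of_ne (hr p) he hpq, leviAt_comp_proj_exc hq l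
          ((hr p).smooth.contMDiffAt.real_log ((hr p).pos q hpq).ne')]
      · have hf : (Finset.univ.filter fun p : {x : M // x ∈ S} => ¬ p.1 ≠ q) = {p₀} := by
          ext p
          simp [Subtype.ext_iff, p₀]
        rw [hf, Finset.sum_singleton, leviAt_log_divWeight_exc hq l (hr p₀) he]
    have hi' : q ∈ L.dom i := hi
    have hj' : q ∈ K.dom j := hj
    rw [hsum, leviAt_comp_proj_exc hq l
      ((hh.contMDiffAt hi').real_log (hh.pos i q hi').ne').neg, leviAt_comp_proj_exc hq l
      ((hg.contMDiffAt hj').real_log (hg.pos j q hj').ne').neg, ← add_assoc]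
    have hm₀ : (0 : ℝ) < m p₀ := by exact_mod_cast hm p₀
    have h0 := levi_log_euclSq_nonneg hd (Function.update u (coordIndex l) 0)
    -- If u is tangent to the divisor, then v = 0 and only Fubini-Study remains. Its degenerate
    -- directions are the multiples of d, and d has coordinate 1 where u has 0, so u ≠ 0 is not one
    -- of them. Otherwise v ≠ 0, and the estimate on M at q applies to v.
    by_cases hu0 : u (coordIndex l) = 0
    · have hv0 : v = 0 := by rw [hv, hu0, zero_smul]
      have hupd : Function.update u (coordIndex l) 0 = u := by rw [← hu0, Function.update_eq_self]
      have hpos' : 0 < levi (fun d => Real.log (euclSq d)) d u := by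
        rw [hupd] at h0
        refine lt_of_le_of_ne h0 fun heq => hu ?_
        obtain ⟨c, hc⟩ := exists_smul_of_levi_log_euclSq_eq_zero hd heq.symm
        have hc0 := congrFun hc (coordIndex l)
        simp only [d, hu0, Pi.smul_apply, Function.update_self, smul_eq_mul, mul_one] at hc0
        rw [hc, ← hc0, zero_smul]
      change 0 < k * leviAt (Fin n → ℂ) _ q v + leviAt (Fin n → ℂ) _ q v + _ + _
      simp only [hv0, leviAt_zero_right, mul_zero, Finset.sum_const_zero, add_zero, zero_add, hupd]
      exact mul_pos hm₀ hpos'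
    · exact add_pos_of_pos_of_nonneg (hpos v (smul_ne_zero hu0 hd)) (mul_nonneg hm₀.le h0)

end Blowup

end

/-! ### The theorem -/

theorem mainTheorem4 {n : ℕ} {M : Type*} [TopologicalSpace M] [T2Space M] [CompactSpace M]
    [ChartedSpace (Fin n → ℂ) M] [IsManifold 𝓘(ℂ, Fin n → ℂ) ω M]
    (S : Finset M) (m : {x : M // x ∈ S} → ℕ) (hm : ∀ p, 0 < m p)
    (L K : HolLineBundle n M) (hL : L.IsPositive) :
    ∃ k₀ : ℕ, ∀ k : ℕ, k₀ ≤ k →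
      ((((L.tpow k).tensor K).pullback Blowup.proj (Blowup.contMDiff_proj n S)).tensor
        ((Blowup.exceptionalEquations n S).lineBundle fun p => -(m p : ℤ))).IsPositive := by
  obtain ⟨h, hh, hpos⟩ := L.isPositive_iff.1 hL
  obtain ⟨g, hg⟩ := K.exists_isMetricWeight
  choose r hr using fun p : {x : M // x ∈ S} => exists_isSquaredDistance n p.1
  obtain ⟨k₀, hk₀⟩ := exists_forall_baseLevi_pos hh hg hr m hpos
  refine ⟨k₀, fun k hk => (HolLineBundle.isPositive_iff _).2 ⟨_,
    (((hh.tpow k).tensor hg).pullback (Blowup.contMDiff_proj n S)).tensor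
      (Blowup.isMetricWeight_lineBundle hr m), ?_⟩⟩
  rintro ⟨⟨i, j⟩, e⟩ b ⟨⟨hi, hj⟩, he⟩ u hu
  exact Blowup.leviAt_weight_pos hh hg hr hm hi hj he (hk₀ k hk b.proj i j hi hj) u hu
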